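/- Fix an integer $n\ge 2$, a real number $\mu>1$ and put $\binom{N}{\alpha}=0$ for $\alpha<0$ or $\alpha>N$. Define masks $a^{(n,m)}=(a^{(n,m)}_\alpha)_{\alpha\in\mathbb Z}$, $m\in\mathbb Z_+=\{0,1,2,\dots\}$, by $a^{(n,0)}_0=a^{(n,0)}_1=\tfrac12$, $a^{(n,0)}_\alpha=0$ otherwise, and, for $m\ge1$, $$a^{(n,m)}_\alpha=\frac1{2^{\,n+1+m^{-\mu}}}\left[\binom{n+1}{\alpha}+4\bigl(2^{m^{-\mu}}-1\bigr)\binom{n-1}{\alpha-1}\right],\qquad \alpha\in\mathbb Z ,$$ and let $a^{(n)}_\alpha=2^{-(n+1)}\binom{n+1}{\alpha}$ be the mask of the B-spline of degree $n$. Let $\varphi^{(n,m)}$ be the refinable functions of the masks $a^{(n,m)}$ and $B^{(n,m)}$ those of the constant mask sequence $a^{(n)}$, that is, with $\hat f(\omega)=\int_{\mathbb R} f(x)e^{-i\omega x}\,dx$, $$\widehat{\varphi}^{(n,m)}(\omega)=\prod_{k\ge m}\ \sum_{\alpha=0}^{n+1}a^{(n,k)}_\alpha e^{-i\alpha\omega/2^{k+1}},\qquad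 \widehat{B}^{(n,m)}(\omega)=\prod_{k\ge m}\ \sum_{\alpha=0}^{n+1}a^{(n)}_\alpha e^{-i\alpha\omega/2^{k+1}} .$$ The nonstationary and the stationary (B-spline) prewavelet coefficients are $$g^{(n,m)}_\alpha=2^{-m}\int_{\mathbb R}\varphi^{(n,m)}(x)\,\varphi^{(n,m+1)}\bigl(x+2^{-(m+1)}\alpha\bigr)\,dx,\qquad g^{(n)}_\alpha=\int_{\mathbb R}B^{(n,0)}(x)\,B^{(n,1)}\bigl(x+\tfrac{\alpha}{2}\bigr)\,dx .$$ Let $\sigma_g^{(n,0)}=\{-n-1,\dots,n\}$ and $\sigma_g^{(n,m)}=\{-2n-1,\dots,n\}$ for $m\ge1$; let $M^{(n,m)}=[g^{(n,m)}_\alpha]_{\alpha\in\sigma_g^{(n,m)}}$, and let $M^{(n)}$ denote the vector of the $g^{(n)}_\alpha$ listed on the index set $\sigma_g^{(n,m)}$ of the level $m$ at hand. Let $C^{(n,m)}=(c^{(n,m)}_{2\alpha-\beta})_{\alpha\in\sigma_g^{(n,m)},\,\beta\in\sigma_g^{(n,m+1)}}$ with $$c^{(n,m)}_\alpha=2\sum_{\beta=0}^{n+1}a^{(n,m)}_\beta\,a^{(n,m+1)}_{\alpha+2\beta},$$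 and define $$P^{(n,m)}_0=M^{(n)},\qquad P^{(n,m)}_{k+1}=C^{(n,m)}P^{(n,m+1)}_k\quad(k\ge0).$$ Let $\|\cdot\|$ be any choice of a norm on $\mathbb R^{\sigma}$ for every finite $\sigma\subset\mathbb Z$. **Theorem.** For every $m\in\mathbb Z_+$ the sequence $P^{(n,m)}_k$ converges to $M^{(n,m)}$ in norm as $k\to\infty$. Moreover, there is a constant $\gamma_{n,m}>0$, independent of $k$ (it may depend on $n,m,\mu$ and the norms), such that $$\|P^{(n,m)}_k-M^{(n,m)}\|\le\gamma_{n,m}\,\|M^{(n)}-M^{(n,m+k)}\|\qquad\text{for all }k\ge0 .$$ -/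

import Mathlib

open Filter Topology MeasureTheory
open scoped FourierTransform

noncomputable section

namespace Prewavelet

/-- The binomial coefficient `binom N k` for an integer `k`, equal to `0` for `k < 0` and `k > N`. -/
def binom (N : ℕ) (k : ℤ) : ℝ :=
  if 0 ≤ k then (N.choose k.toNat : ℝ) else 0

/-- The nonstationary scaling mask `a^{(n,m)}` with tension parameter `μ`, as a sequence on `ℤ`. -/
def mask (n : ℕ) (μ : ℝ) (m : ℕ) (α : ℤ) : ℝ :=
  if m = 0 then
    if α = 0 ∨ α = 1 then 1 / 2 else 0
  else
    (1 / (2 : ℝ) ^ ((n : ℝ) + 1 + (m : ℝ) ^ (-μ))) *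
      (binom (n + 1) α + 4 * ((2 : ℝ) ^ ((m : ℝ) ^ (-μ)) - 1) * binom (n - 1) (α - 1))

/-- The stationary fundamental mask `a^{(n)}`: the mask of the B-spline of degree `n`. -/
def splineMask (n : ℕ) (α : ℤ) : ℝ :=
  (1 / (2 : ℝ) ^ (n + 1)) * binom (n + 1) α

/-- The symbol `A(z) = ∑ a_α z^α` of a mask supported in `[0, n + 1]`. -/
def symbol (n : ℕ) (a : ℤ → ℝ) (z : ℂ) : ℂ :=
  ∑ α ∈ Finset.Icc (0 : ℤ) (n + 1), (a α : ℂ) * z ^ α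

/-- The Fourier transform `ω ↦ ∏_{k ≥ m} A^k (e^{-iω / 2^{k+1}})` of the `m`-th refinable function
of a sequence of masks `a 0, a 1, …` supported in `[0, n + 1]`
(convention: the Fourier transform of `f` is `ω ↦ ∫ f(x) e^{-iωx} dx`). -/
def refinableFT (n : ℕ) (a : ℕ → ℤ → ℝ) (m : ℕ) (ω : ℝ) : ℂ :=
  ∏' j : ℕ, symbol n (a (m + j)) (Complex.exp (-(Complex.I * ω / 2 ^ (m + j + 1))))

/-- The `m`-th refinable function `φ^m` of a sequence of masks, recovered from its Fourier transform:
`φ^m(x) = (2π)⁻¹ ∫ φ̂^m(ω) e^{iωx} dω`, which is `∫ φ̂^m(2πξ) e^{2πiξx} dξ`.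
It is real-valued and has integral `1`. -/
def refinable (n : ℕ) (a : ℕ → ℤ → ℝ) (m : ℕ) (x : ℝ) : ℝ :=
  (𝓕⁻ (fun ξ : ℝ => refinableFT n a m (2 * Real.pi * ξ)) x).re

/-- The prewavelet coefficient of index `α` at level `m` for a sequence of masks:
`g_α = 2^{-m} ∫ φ^m(x) φ^{m+1}(x + 2^{-(m+1)} α) dx`. The factor `2^{-m}` compensates the
normalization `∫ φ^m = 1`; for a constant sequence of masks it makes `g_α` independent of `m`. -/
def prewaveletCoeff (n : ℕ) (a : ℕ → ℤ → ℝ) (m : ℕ) (α : ℤ) : ℝ :=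
  (1 / (2 : ℝ) ^ m) *
    ∫ x : ℝ, refinable n a m x * refinable n a (m + 1) (x + (α : ℝ) / 2 ^ (m + 1))

/-- The index set `σ_g^{(n,m)}`. -/
def sigmaG (n m : ℕ) : Finset ℤ :=
  if m = 0 then Finset.Icc (-(n : ℤ) - 1) n else Finset.Icc (-2 * (n : ℤ) - 1) n

/-- The vector `M^{(n,m)}` of nonstationary prewavelet coefficients. -/
def coeffVec (n : ℕ) (μ : ℝ) (m : ℕ) : sigmaG n m → ℝ :=
  fun α => prewaveletCoeff n (mask n μ) m α

/-- The vector `M^{(n)}` of prewavelet coefficients of the stationary mask `a^{(n)}`, listed on the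
index set `σ_g^{(n,m)}`. The coefficients themselves do not depend on `m`. -/
def splineCoeffVec (n m : ℕ) : sigmaG n m → ℝ :=
  fun α => prewaveletCoeff n (fun _ => splineMask n) 0 α

/-- The sequence `c_α^{(n,m)} = 2 ∑_β a_β^{(n,m)} a_{α+2β}^{(n,m+1)}`. -/
def iterMask (n : ℕ) (μ : ℝ) (m : ℕ) (α : ℤ) : ℝ :=
  2 * ∑ β ∈ Finset.Icc (0 : ℤ) (n + 1), mask n μ m β * mask n μ (m + 1) (α + 2 * β)

/-- The matrix `C^{(n,m)} = (c_{2α-β}^{(n,m)})`, with `α ∈ σ_g^{(n,m)}` and `β ∈ σ_g^{(n,m+1)}`. -/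
def iterMatrix (n : ℕ) (μ : ℝ) (m : ℕ) : Matrix (sigmaG n m) (sigmaG n (m + 1)) ℝ :=
  Matrix.of fun α β => iterMask n μ m (2 * (α : ℤ) - (β : ℤ))

/-- The iteration `P_0^{(n,m)} = M^{(n)}`, `P_{k+1}^{(n,m)} = C^{(n,m)} P_k^{(n,m+1)}`. -/
def iterVec (n : ℕ) (μ : ℝ) : (k m : ℕ) → sigmaG n m → ℝ
  | 0, m => splineCoeffVec n m
  | k + 1, m => (iterMatrix n μ m).mulVec (iterVec n μ k (m + 1))

end Prewavelet

end

namespace Prewavelet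

/-! For m ≥ 1 the mask at level m is the convex combination, with weight τ_m = 2^(-m^(-μ)), of the
spline mask of degree n and the centred spline mask of degree n - 2. The weights lie in [1/2, 1],
and μ > 1 makes ∑ (1 - τ_m) finite; `Admissible` records exactly this.

Inserting the refinement equation in both factors of the coefficient integral gives M^(n,m) =
C^(n,m) M^(n,m+1) (`coeffVec_eq_mulVec`), so P_k - M^(n,m) is a product of k matrices applied to
M^(n) - M^(n,m+k). The matrices are nonnegative. From level 1 on the symbols vanish at -1, so each
parity class of a mask has sum 1/2 and the column sums of C are at most 1. Hence C does not expand
the ℓ¹ norm, which gives the estimate with constant 1 in ℓ¹ (`sum_abs_iterVec_sub_le`); equivalence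
of norms gives the rest.

Convergence then amounts to M^(n,m) → M^(n) (`tendsto_sum_abs_blendCoeff_sub`). Both vectors have
coordinate sum 2, because the refinable functions have integral 1 and their integer shifts sum to 1.
On vectors of sum zero the matrices contract by a fixed factor 1 - η, since one row is bounded
below. The ℓ¹ errors thus satisfy e_m ≤ (1 - η) e_(m+1) + r_m with r_m → 0, and this forces e_m → 0
as soon as e is bounded.

Boundedness is the analytic core. On the unit circle the symbol is at most 1 - τ/2 + (τ/2) cos θ,
and the product of these majorants integrates over one period to ∏ (2 - τ_j) ≤ exp ∑ (1 - τ_j). This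
bounds the L¹ norm of the Fourier transform (`integral_norm_blendFT_le`), hence the sup norm of the
refinable functions, uniformly in the level. -/

/-- The convex combination, with weight `τ`, of the spline mask of degree `n` and the centred
spline mask of degree `n - 2`. -/
noncomputable def blend (n : ℕ) (τ : ℝ) (α : ℤ) : ℝ :=
  τ * splineMask n α + (1 - τ) * ((1 / (2 : ℝ) ^ (n - 1)) * binom (n - 1) (α - 1))

/-! ### Blended masks, their symbols and sum rules -/

theorem sum_Icc_int {M : Type*} [AddCommMonoid M] (N : ℕ) (f : ℤ → M) :
    ∑ α ∈ Finset.Icc (0 : ℤ) N, f α = ∑ i ∈ Finset.range (N + 1), f i := by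
  symm
  refine Finset.sum_bij (fun i _ => (i : ℤ)) ?_ ?_ ?_ ?_
  · intro i hi
    simp only [Finset.mem_range, Finset.mem_Icc] at *
    omega
  · intro i _ j _ h
    exact_mod_cast h
  · intro α hα
    simp only [Finset.mem_Icc] at hα
    exact ⟨α.toNat, by simp only [Finset.mem_range]; omega, by omega⟩
  · simp

theorem binom_nonneg (N : ℕ) (k : ℤ) : 0 ≤ binom N k := by
  unfold binom; split_ifs <;> positivity

theorem binom_natCast (N k : ℕ) : binom N k = N.choose k := by
  simp [binom]

theorem binom_eq_zero {N : ℕ} {k : ℤ} (h : k ∉ Finset.Icc (0 : ℤ) N) : binom N k = 0 := by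
  simp only [Finset.mem_Icc, not_and_or, not_le] at h
  unfold binom
  split_ifs with h0
  · rw [Nat.choose_eq_zero_of_lt (by omega), Nat.cast_zero]
  · rfl

theorem one_le_binom {N : ℕ} {k : ℤ} (h : k ∈ Finset.Icc (0 : ℤ) N) : 1 ≤ binom N k := by
  simp only [Finset.mem_Icc] at h
  unfold binom
  rw [if_pos h.1]
  exact_mod_cast Nat.choose_pos (by omega)

theorem blend_nonneg (n : ℕ) {τ : ℝ} (h0 : 0 ≤ τ) (h1 : τ ≤ 1) (α : ℤ) : 0 ≤ blend n τ α := by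
  have := binom_nonneg (n + 1) α
  have := binom_nonneg (n - 1) (α - 1)
  have : 0 ≤ 1 - τ := by linarith
  unfold blend splineMask
  positivity

theorem blend_eq_zero {n : ℕ} (τ : ℝ) {α : ℤ} (h : α ∉ Finset.Icc (0 : ℤ) (n + 1)) :
    blend n τ α = 0 := by
  have h1 : binom (n + 1) α = 0 := binom_eq_zero (by exact_mod_cast h)
  have h2 : binom (n - 1) (α - 1) = 0 := binom_eq_zero (by
    simp only [Finset.mem_Icc] at h ⊢
    omega)
  simp [blend, splineMask, h1, h2]

theorem le_blend {n : ℕ} {τ : ℝ} (h0 : 1 / 2 ≤ τ) (h1 : τ ≤ 1) {α : ℤ}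
    (h : α ∈ Finset.Icc (0 : ℤ) (n + 1)) : 1 / 2 ^ (n + 2) ≤ blend n τ α := by
  have hb : 1 ≤ binom (n + 1) α := one_le_binom (by exact_mod_cast h)
  have := binom_nonneg (n - 1) (α - 1)
  have h3 : 0 ≤ 1 - τ := by linarith
  have h2 : 0 ≤ (1 - τ) * ((1 / (2 : ℝ) ^ (n - 1)) * binom (n - 1) (α - 1)) := by positivity
  have h4 : (1 : ℝ) / 2 ^ (n + 2) = 1 / 2 * ((1 / 2 ^ (n + 1)) * 1) := by
    rw [pow_succ _ (n + 1)]; ring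
  have h5 : (1 : ℝ) / 2 * ((1 / 2 ^ (n + 1)) * 1) ≤ τ * ((1 / 2 ^ (n + 1)) * binom (n + 1) α) := by
    gcongr
  unfold blend splineMask
  linarith

theorem splineMask_eq_blend (n : ℕ) : splineMask n = blend n 1 := by
  ext α; simp [blend]

/-- With s = m^(-μ), the factor 4(2^s - 1)/2^(n+1+s) equals (1 - 2^(-s))/2^(n-1). -/
theorem mask_eq_blend {n : ℕ} (hn : 1 ≤ n) (μ : ℝ) {m : ℕ} (hm : m ≠ 0) :
    mask n μ m = blend n ((2 : ℝ) ^ (-(m : ℝ) ^ (-μ))) := by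
  ext α
  obtain ⟨k, rfl⟩ : ∃ k, n = k + 1 := ⟨n - 1, by omega⟩
  simp only [mask, hm, if_false, blend, splineMask, Nat.add_sub_cancel]
  set s := (m : ℝ) ^ (-μ)
  rw [Real.rpow_add two_pos, Real.rpow_neg two_pos.le]
  have h : (2 : ℝ) ^ s ≠ 0 := (Real.rpow_pos_of_pos two_pos s).ne'
  have h2 : (2 : ℝ) ^ (((k + 1 : ℕ) : ℝ) + 1) = 2 ^ k * 4 := by
    rw [show (((k + 1 : ℕ) : ℝ) + 1) = ((k + 2 : ℕ) : ℝ) by push_cast; ring, Real.rpow_natCast,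
      pow_add]
    norm_num
  rw [h2, show k + 1 + 1 = k + 2 from rfl, pow_add (2 : ℝ) k 2]
  field_simp
  ring

theorem symbol_binom (N : ℕ) (z : ℂ) :
    ∑ α ∈ Finset.Icc (0 : ℤ) N, (binom N α : ℂ) * z ^ α = (1 + z) ^ N := by
  rw [sum_Icc_int, add_comm 1 z, add_pow]
  refine Finset.sum_congr rfl fun i _ => ?_
  rw [binom_natCast]
  simp [mul_comm]

theorem symbol_binom_shift (N : ℕ) (z : ℂ) :
    ∑ α ∈ Finset.Icc (0 : ℤ) (N + 2 : ℕ), (binom N (α - 1) : ℂ) * z ^ α = z * (1 + z) ^ N := by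
  rw [sum_Icc_int, Finset.sum_range_succ', ← symbol_binom, sum_Icc_int, Finset.mul_sum,
    Finset.sum_range_succ]
  have h0 : binom N (((0 : ℕ) : ℤ) - 1) = 0 := binom_eq_zero (by simp)
  have h1 : binom N (((N + 1 + 1 : ℕ) : ℤ) - 1) = 0 := binom_eq_zero (by simp)
  rw [h0, h1]
  simp only [Complex.ofReal_zero, zero_mul, add_zero]
  refine Finset.sum_congr rfl fun i _ => ?_
  rw [show (((i + 1 : ℕ) : ℤ) - 1) = i by push_cast; ring, zpow_natCast, zpow_natCast, pow_succ]
  ring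

theorem symbol_blend {n : ℕ} (hn : 1 ≤ n) (τ : ℝ) (z : ℂ) :
    symbol n (blend n τ) z =
      ((1 + z) / 2) ^ (n - 1) * (τ * ((1 + z) / 2) ^ 2 + (1 - τ) * z) := by
  obtain ⟨k, rfl⟩ : ∃ k, n = k + 1 := ⟨n - 1, by omega⟩
  have h1 := symbol_binom (k + 2) z
  have h2 := symbol_binom_shift k z
  have e : ((k + 1 : ℕ) : ℤ) + 1 = ((k + 2 : ℕ) : ℤ) := by push_cast; ring
  simp only [symbol, blend, splineMask, Nat.add_sub_cancel, e]
  have : ∀ α : ℤ, ((τ * (1 / 2 ^ (k + 1 + 1) * binom (k + 1 + 1) α) +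
      (1 - τ) * (1 / 2 ^ k * binom k (α - 1)) : ℝ) : ℂ) * z ^ α =
      τ * (1 / 2 ^ (k + 2)) * (binom (k + 2) α * z ^ α) +
      (1 - τ) * (1 / 2 ^ k) * (binom k (α - 1) * z ^ α) := by
    intro α
    push_cast
    ring
  simp only [this]
  rw [Finset.sum_add_distrib, ← Finset.mul_sum, ← Finset.mul_sum, h1, h2, div_pow, div_pow,
    pow_add, pow_add]
  field_simp

theorem symbol_blend_one {n : ℕ} (hn : 1 ≤ n) (τ : ℝ) : symbol n (blend n τ) 1 = 1 := by
  rw [symbol_blend hn]; norm_num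

theorem symbol_blend_neg_one {n : ℕ} (hn : 2 ≤ n) (τ : ℝ) : symbol n (blend n τ) (-1) = 0 := by
  rw [symbol_blend (by omega)]
  simp [show n - 1 ≠ 0 by omega]

theorem sum_blend {n : ℕ} (hn : 1 ≤ n) (τ : ℝ) :
    ∑ α ∈ Finset.Icc (0 : ℤ) (n + 1), blend n τ α = 1 := by
  have := symbol_blend_one hn τ
  simp only [symbol, one_zpow, mul_one] at this
  exact_mod_cast this

theorem sum_neg_one_zpow_blend {n : ℕ} (hn : 2 ≤ n) (τ : ℝ) :
    ∑ α ∈ Finset.Icc (0 : ℤ) (n + 1), blend n τ α * (-1) ^ α = 0 := by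
  have := symbol_blend_neg_one hn τ
  rw [← Complex.ofReal_eq_zero, ← this, symbol]
  push_cast
  rfl

/-- The symbol is 1 at 1 and 0 at -1; averaging the two with the sign (-1)^δ selects one parity
class. -/
theorem sum_blend_congr {n : ℕ} (hn : 2 ≤ n) (τ : ℝ) (δ : ℤ) :
    ∑ γ ∈ Finset.Icc (0 : ℤ) (n + 1) with 2 ∣ γ + δ, blend n τ γ = 1 / 2 := by
  have h1 := sum_blend (n := n) (by omega) τ
  have h2 := sum_neg_one_zpow_blend hn τ
  have key : ∀ γ : ℤ, (if 2 ∣ γ + δ then blend n τ γ else 0) =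
      1 / 2 * blend n τ γ + 1 / 2 * (-1) ^ δ * (blend n τ γ * (-1) ^ γ) := by
    intro γ
    have h3 : (1 / 2 : ℝ) * (-1) ^ δ * (blend n τ γ * (-1) ^ γ) =
        1 / 2 * blend n τ γ * (-1) ^ (γ + δ) := by
      rw [zpow_add₀ (by norm_num)]; ring
    rw [h3]
    split_ifs with h
    · rw [Even.neg_one_zpow (even_iff_two_dvd.2 h)]; ring
    · rw [Odd.neg_one_zpow (Int.not_even_iff_odd.1 (fun h' => h (even_iff_two_dvd.1 h')))]; ring
  rw [Finset.sum_filter, Finset.sum_congr rfl fun γ _ => key γ, Finset.sum_add_distrib,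
    ← Finset.mul_sum, ← Finset.mul_sum, h1, h2]
  ring

theorem sum_blend_comp {n : ℕ} (hn : 2 ≤ n) (τ : ℝ) (δ : ℤ) (A : Finset ℤ)
    (hA : ∀ α : ℤ, 2 * α - δ ∈ Finset.Icc (0 : ℤ) (n + 1) → α ∈ A) :
    ∑ α ∈ A, blend n τ (2 * α - δ) = 1 / 2 := by
  rw [← sum_blend_congr hn τ δ]
  refine Finset.sum_bij_ne_zero (fun α _ _ => 2 * α - δ) ?_ ?_ ?_ ?_
  · intro α _ h0
    refine Finset.mem_filter.2 ⟨?_, ⟨α, by ring⟩⟩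
    by_contra h
    exact h0 (blend_eq_zero τ h)
  · intro α _ _ β _ _ h
    linarith
  · intro γ hγ _
    obtain ⟨h1, α, h2⟩ := Finset.mem_filter.1 hγ
    have h3 : 2 * α - δ = γ := by linarith
    exact ⟨α, hA α (h3 ▸ h1), by rwa [h3], h3⟩
  · simp

theorem sum_blend_comp_le {n : ℕ} (hn : 2 ≤ n) {τ : ℝ} (h0 : 0 ≤ τ) (h1 : τ ≤ 1) (δ : ℤ)
    (A : Finset ℤ) : ∑ α ∈ A, blend n τ (2 * α - δ) ≤ 1 / 2 := by
  rw [← sum_blend_comp hn τ δ (A ∪ Finset.Icc (-|δ|) (n + 1 + |δ|)) (fun α h => by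
    simp only [Finset.mem_Icc, Finset.mem_union] at h ⊢
    have := le_abs_self δ
    have := neg_abs_le δ
    right; omega)]
  exact Finset.sum_le_sum_of_subset_of_nonneg Finset.subset_union_left
    fun _ _ _ => blend_nonneg n h0 h1 _

/-! ### Two-scale kernels: column sums and contraction -/

/-- The sequence `c_j = 2 ∑_β a_β b_{j+2β}` of two consecutive masks `a`, `b`. -/
noncomputable def twoScale (n : ℕ) (a b : ℤ → ℝ) (j : ℤ) : ℝ :=
  2 * ∑ β ∈ Finset.Icc (0 : ℤ) (n + 1), a β * b (j + 2 * β)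

/-- The index set `{-2n-1, …, n}` of all prewavelet coefficients at positive levels. -/
noncomputable def window (n : ℕ) : Finset ℤ := Finset.Icc (-2 * (n : ℤ) - 1) n

theorem twoScale_nonneg {n : ℕ} {a b : ℤ → ℝ} (ha : ∀ α, 0 ≤ a α) (hb : ∀ α, 0 ≤ b α) (j : ℤ) :
    0 ≤ twoScale n a b j :=
  mul_nonneg two_pos.le (Finset.sum_nonneg fun _ _ => mul_nonneg (ha _) (hb _))

theorem sum_twoScale (n : ℕ) (a b : ℤ → ℝ) (δ : ℤ) (A : Finset ℤ) :
    ∑ α ∈ A, twoScale n a b (2 * α - δ) =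
      2 * ∑ β ∈ Finset.Icc (0 : ℤ) (n + 1), a β * ∑ α ∈ A, b (2 * α - (δ - 2 * β)) := by
  simp only [twoScale, ← Finset.mul_sum]
  rw [Finset.sum_comm]
  simp only [Finset.mul_sum]
  refine Finset.sum_congr rfl fun β _ => Finset.sum_congr rfl fun α _ => ?_
  rw [show 2 * α - δ + 2 * β = 2 * α - (δ - 2 * β) by ring]

theorem sum_twoScale_le {n : ℕ} (hn : 2 ≤ n) {a : ℤ → ℝ} (ha : ∀ α, 0 ≤ a α)
    (ha1 : ∑ α ∈ Finset.Icc (0 : ℤ) (n + 1), a α = 1) {τ : ℝ} (h0 : 0 ≤ τ) (h1 : τ ≤ 1)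
    (δ : ℤ) (A : Finset ℤ) : ∑ α ∈ A, twoScale n a (blend n τ) (2 * α - δ) ≤ 1 := by
  have h : ∑ β ∈ Finset.Icc (0 : ℤ) (n + 1),
      a β * ∑ α ∈ A, blend n τ (2 * α - (δ - 2 * β)) ≤
      ∑ β ∈ Finset.Icc (0 : ℤ) (n + 1), a β * (1 / 2) :=
    Finset.sum_le_sum fun β _ =>
      mul_le_mul_of_nonneg_left (sum_blend_comp_le hn h0 h1 _ A) (ha β)
  rw [← Finset.sum_mul, ha1] at h
  rw [sum_twoScale]
  linarith

theorem sum_twoScale_window {n : ℕ} (hn : 2 ≤ n) {a : ℤ → ℝ}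
    (ha1 : ∑ α ∈ Finset.Icc (0 : ℤ) (n + 1), a α = 1) (τ : ℝ) {δ : ℤ} (hδ : δ ∈ window n) :
    ∑ α ∈ window n, twoScale n a (blend n τ) (2 * α - δ) = 1 := by
  have h : ∑ β ∈ Finset.Icc (0 : ℤ) (n + 1),
      a β * ∑ α ∈ window n, blend n τ (2 * α - (δ - 2 * β)) =
      ∑ β ∈ Finset.Icc (0 : ℤ) (n + 1), a β * (1 / 2) := by
    -- The window is invariant: 2α lies between δ - 2β and δ - 2β + n + 1, hence between -4n - 3 and
    -- 2n + 1, so no index α is lost.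
    refine Finset.sum_congr rfl fun β hβ => ?_
    rw [sum_blend_comp hn τ _ _ fun α hα => ?_]
    simp only [window, Finset.mem_Icc] at *
    omega
  rw [← Finset.sum_mul, ha1] at h
  rw [sum_twoScale, h]
  norm_num

theorem le_twoScale {n : ℕ} {σ τ : ℝ} (hσ0 : 1 / 2 ≤ σ) (hσ1 : σ ≤ 1) (hτ0 : 1 / 2 ≤ τ)
    (hτ1 : τ ≤ 1) {j : ℤ} (hj : j ∈ Finset.Icc (-2 * (n : ℤ) - 2) (n + 1)) :
    2 * (1 / 2 ^ (n + 2)) ^ 2 ≤ twoScale n (blend n σ) (blend n τ) j := by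
  simp only [Finset.mem_Icc] at hj
  obtain ⟨β, hβ, hjβ⟩ : ∃ β ∈ Finset.Icc (0 : ℤ) (n + 1),
      j + 2 * β ∈ Finset.Icc (0 : ℤ) (n + 1) := by
    -- For j ≤ 1 this choice brings j + 2β to 0 or 1; for larger j it is β = 0.
    refine ⟨max 0 ((1 - j) / 2), ?_, ?_⟩ <;> simp only [Finset.mem_Icc] <;> omega
  have h1 := le_blend hσ0 hσ1 hβ
  have h2 := le_blend hτ0 hτ1 hjβ
  have h3 : (1 / 2 ^ (n + 2) : ℝ) ^ 2 ≤ blend n σ β * blend n τ (j + 2 * β) := by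
    rw [sq]
    exact mul_le_mul h1 h2 (by positivity) (blend_nonneg n (by linarith) hσ1 _)
  refine mul_le_mul_of_nonneg_left (h3.trans ?_) two_pos.le
  exact Finset.single_le_sum (f := fun β => blend n σ β * blend n τ (j + 2 * β)) (fun γ _ =>
    mul_nonneg (blend_nonneg n (by linarith) hσ1 _) (blend_nonneg n (by linarith) hτ1 _)) hβ

/-- A nonnegative kernel with column sums at most `1` is nonexpansive for the `ℓ¹` norm. -/
theorem sum_abs_sum_le {ι κ : Type*} (A : Finset ι) (B : Finset κ) (c : ι → κ → ℝ)
    (hc : ∀ i ∈ A, ∀ j ∈ B, 0 ≤ c i j) (h1 : ∀ j ∈ B, ∑ i ∈ A, c i j ≤ 1) (v : κ → ℝ) :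
    ∑ i ∈ A, |∑ j ∈ B, c i j * v j| ≤ ∑ j ∈ B, |v j| := by
  calc ∑ i ∈ A, |∑ j ∈ B, c i j * v j| ≤ ∑ i ∈ A, ∑ j ∈ B, c i j * |v j| := by
        refine Finset.sum_le_sum fun i hi => (Finset.abs_sum_le_sum_abs _ _).trans_eq ?_
        exact Finset.sum_congr rfl fun j hj => by rw [abs_mul, abs_of_nonneg (hc i hi j hj)]
    _ = ∑ j ∈ B, (∑ i ∈ A, c i j) * |v j| := by
        rw [Finset.sum_comm]; simp only [Finset.sum_mul]
    _ ≤ ∑ j ∈ B, 1 * |v j| :=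
        Finset.sum_le_sum fun j hj => mul_le_mul_of_nonneg_right (h1 j hj) (abs_nonneg _)
    _ = ∑ j ∈ B, |v j| := by simp

/-- A nonnegative column-stochastic kernel with a row bounded below by `η` contracts the `ℓ¹` norm
of vectors of sum zero by the factor `1 - η`. -/
theorem sum_abs_sum_le_contract {ι κ : Type*} [DecidableEq ι] (A : Finset ι) (B : Finset κ)
    (c : ι → κ → ℝ) (hc : ∀ i ∈ A, ∀ j ∈ B, 0 ≤ c i j) (h1 : ∀ j ∈ B, ∑ i ∈ A, c i j ≤ 1) {η : ℝ}
    {i₀ : ι} (hi₀ : i₀ ∈ A) (hη : ∀ j ∈ B, η ≤ c i₀ j) (v : κ → ℝ) (hv : ∑ j ∈ B, v j = 0) :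
    ∑ i ∈ A, |∑ j ∈ B, c i j * v j| ≤ (1 - η) * ∑ j ∈ B, |v j| := by
  -- Subtracting the constant η from the row i₀ is invisible to vectors of sum zero and lowers every
  -- column sum by η.
  set d : ι → κ → ℝ := fun i j => c i j - if i = i₀ then η else 0
  have hd : ∀ i, ∑ j ∈ B, c i j * v j = ∑ j ∈ B, d i j * v j := by
    intro i
    simp only [d, sub_mul, Finset.sum_sub_distrib, ← Finset.mul_sum, hv, mul_zero, sub_zero]
  have hd0 : ∀ i ∈ A, ∀ j ∈ B, 0 ≤ d i j := by
    intro i hi j hj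
    simp only [d]
    split_ifs with h
    · subst h; linarith [hη j hj]
    · linarith [hc i hi j hj]
  have hd1 : ∀ j ∈ B, ∑ i ∈ A, d i j ≤ 1 - η := by
    intro j hj
    simp only [d, Finset.sum_sub_distrib, Finset.sum_ite_eq', hi₀, if_true]
    linarith [h1 j hj]
  calc ∑ i ∈ A, |∑ j ∈ B, c i j * v j| ≤ ∑ i ∈ A, ∑ j ∈ B, d i j * |v j| := by
        refine Finset.sum_le_sum fun i hi => ?_
        rw [hd]
        refine (Finset.abs_sum_le_sum_abs _ _).trans_eq ?_
        exact Finset.sum_congr rfl fun j hj => by rw [abs_mul, abs_of_nonneg (hd0 i hi j hj)]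
    _ = ∑ j ∈ B, (∑ i ∈ A, d i j) * |v j| := by
        rw [Finset.sum_comm]; simp only [Finset.sum_mul]
    _ ≤ ∑ j ∈ B, (1 - η) * |v j| :=
        Finset.sum_le_sum fun j hj => mul_le_mul_of_nonneg_right (hd1 j hj) (abs_nonneg _)
    _ = (1 - η) * ∑ j ∈ B, |v j| := by rw [Finset.mul_sum]

/-- The row i₀ = ⌊-(n+1)/2⌋ is central: for every δ in the window, 2i₀ - δ falls in [-2n-2, n+1],
where the kernel is bounded below. -/
theorem twoScale_blend_contract {n : ℕ} (hn : 2 ≤ n) {σ τ : ℝ} (hσ0 : 1 / 2 ≤ σ) (hσ1 : σ ≤ 1)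
    (hτ0 : 1 / 2 ≤ τ) (hτ1 : τ ≤ 1) (v : ℤ → ℝ) (hv : ∑ δ ∈ window n, v δ = 0) :
    ∑ α ∈ window n, |∑ δ ∈ window n, twoScale n (blend n σ) (blend n τ) (2 * α - δ) * v δ| ≤
      (1 - 2 * (1 / 2 ^ (n + 2)) ^ 2) * ∑ δ ∈ window n, |v δ| := by
  refine sum_abs_sum_le_contract _ _
    (fun α δ => twoScale n (blend n σ) (blend n τ) (2 * α - δ)) (fun α _ δ _ => ?_)
    (fun δ hδ => ?_) (i₀ := -((n : ℤ) + 1) / 2) ?_ (fun δ hδ => ?_) v hv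
  · exact twoScale_nonneg (blend_nonneg n (by linarith) hσ1) (blend_nonneg n (by linarith) hτ1) _
  · exact (sum_twoScale_window hn (sum_blend (by omega) σ) τ hδ).le
  · simp only [window, Finset.mem_Icc]; omega
  · refine le_twoScale hσ0 hσ1 hτ0 hτ1 ?_
    simp only [window, Finset.mem_Icc] at *
    omega

/-! ### Estimates of the symbol on the unit circle -/

theorem norm_cexp_neg_I_mul (θ : ℝ) : ‖Complex.exp (-(Complex.I * θ))‖ = 1 := by
  rw [Complex.norm_exp]; simp

theorem cexp_neg_I_mul_zpow (θ : ℝ) (α : ℤ) :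
    Complex.exp (-(Complex.I * θ)) ^ α = Complex.exp (Complex.I * ((-α * θ : ℝ) : ℂ)) := by
  rw [← Complex.exp_int_mul]; push_cast; ring_nf

theorem norm_cexp_I_mul_sub_le (x y : ℝ) :
    ‖Complex.exp (Complex.I * x) - Complex.exp (Complex.I * y)‖ ≤ |x - y| := by
  have h : Complex.exp (Complex.I * x) - Complex.exp (Complex.I * y) =
      Complex.exp (Complex.I * y) * (Complex.exp (Complex.I * ((x - y : ℝ) : ℂ)) - 1) := by
    rw [mul_sub, ← Complex.exp_add]; push_cast; ring_nf
  rw [h, norm_mul, mul_comm Complex.I (y : ℂ), Complex.norm_exp_ofReal_mul_I, one_mul]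
  exact Real.norm_exp_I_mul_ofReal_sub_one_le

theorem norm_symbol_sub_le {n : ℕ} {a : ℤ → ℝ} (ha : ∀ α, 0 ≤ a α)
    (ha1 : ∑ α ∈ Finset.Icc (0 : ℤ) (n + 1), a α = 1) (x y : ℝ) :
    ‖symbol n a (Complex.exp (-(Complex.I * x))) - symbol n a (Complex.exp (-(Complex.I * y)))‖ ≤
      (n + 1) * |x - y| := by
  rw [symbol, symbol, ← Finset.sum_sub_distrib]
  calc _ ≤ ∑ α ∈ Finset.Icc (0 : ℤ) (n + 1), a α * ((n + 1) * |x - y|) := by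
        refine norm_sum_le_of_le _ fun α hα => ?_
        rw [← mul_sub, norm_mul, Complex.norm_real, Real.norm_of_nonneg (ha α)]
        refine mul_le_mul_of_nonneg_left ?_ (ha α)
        rw [cexp_neg_I_mul_zpow, cexp_neg_I_mul_zpow]
        refine (norm_cexp_I_mul_sub_le _ _).trans ?_
        rw [← mul_sub, abs_mul, abs_neg]
        refine mul_le_mul_of_nonneg_right ?_ (abs_nonneg _)
        simp only [Finset.mem_Icc] at hα
        rw [abs_of_nonneg (by exact_mod_cast hα.1)]
        exact_mod_cast hα.2
    _ = (n + 1) * |x - y| := by rw [← Finset.sum_mul, ha1, one_mul]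

/-- The trigonometric majorant of the symbol of `blend n τ` on the unit circle. -/
noncomputable def majorant (τ θ : ℝ) : ℝ := 1 - τ / 2 + τ / 2 * Real.cos θ

theorem norm_one_add_cexp_sq (θ : ℝ) :
    ‖(1 + Complex.exp (-(Complex.I * θ))) / 2‖ ^ 2 = (1 + Real.cos θ) / 2 := by
  have h : -(Complex.I * θ) = ((-θ : ℝ) : ℂ) * Complex.I := by push_cast; ring
  rw [norm_div, div_pow, Complex.sq_norm, h, Complex.exp_mul_I, ← Complex.ofReal_cos,
    ← Complex.ofReal_sin, Complex.normSq_apply]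
  simp only [Real.cos_neg, Real.sin_neg, Complex.add_re, Complex.add_im, Complex.mul_re,
    Complex.mul_im, Complex.one_re, Complex.one_im, Complex.ofReal_re, Complex.ofReal_im,
    Complex.I_re, Complex.I_im, Complex.norm_ofNat]
  nlinarith [Real.sin_sq_add_cos_sq θ]

/-- The factor ((1+z)/2)^(n-1) is bounded by 1, and the triangle inequality on the other factor
gives τ(1 + cos θ)/2 + 1 - τ. -/
theorem norm_symbol_blend_le {n : ℕ} (hn : 1 ≤ n) {τ : ℝ} (h0 : 0 ≤ τ) (h1 : τ ≤ 1) (θ : ℝ) :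
    ‖symbol n (blend n τ) (Complex.exp (-(Complex.I * θ)))‖ ≤ majorant τ θ := by
  have hz := norm_one_add_cexp_sq θ
  have hw : ‖(1 + Complex.exp (-(Complex.I * θ))) / 2‖ ≤ 1 := by
    have := Real.cos_le_one θ
    nlinarith [norm_nonneg ((1 + Complex.exp (-(Complex.I * θ))) / 2)]
  rw [symbol_blend hn, norm_mul, norm_pow]
  set w := (1 + Complex.exp (-(Complex.I * θ))) / 2
  have h2 : ‖(τ : ℂ) * w ^ 2 + (1 - τ) * Complex.exp (-(Complex.I * θ))‖ ≤ majorant τ θ := by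
    refine (norm_add_le _ _).trans_eq ?_
    rw [norm_mul, norm_mul, norm_cexp_neg_I_mul, norm_pow, hz, Complex.norm_real,
      Real.norm_of_nonneg h0, ← Complex.ofReal_one, ← Complex.ofReal_sub, Complex.norm_real,
      Real.norm_of_nonneg (by linarith), majorant]
    ring
  calc _ ≤ 1 * majorant τ θ :=
        mul_le_mul (pow_le_one₀ (norm_nonneg _) hw) h2 (norm_nonneg _) zero_le_one
    _ = _ := one_mul _

theorem majorant_nonneg {τ : ℝ} (h0 : 0 ≤ τ) (h1 : τ ≤ 1) (θ : ℝ) : 0 ≤ majorant τ θ := by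
  unfold majorant
  nlinarith [Real.neg_one_le_cos θ]

theorem majorant_le_one {τ : ℝ} (h0 : 0 ≤ τ) (θ : ℝ) : majorant τ θ ≤ 1 := by
  unfold majorant
  nlinarith [Real.cos_le_one θ]

theorem majorant_add_pi (τ θ : ℝ) : majorant τ θ + majorant τ (θ + Real.pi) = 2 - τ := by
  simp only [majorant, Real.cos_add_pi]; ring

/-! ### The infinite product: convergence, zeros and L¹ bound -/

/-- Weights in `[1/2, 1]` whose distances to `1` are summable. -/
structure Admissible (t : ℕ → ℝ) : Prop where
  half_le : ∀ k, 1 / 2 ≤ t k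
  le_one : ∀ k, t k ≤ 1
  summable : Summable fun k => 1 - t k

namespace Admissible

variable {t : ℕ → ℝ}

theorem nonneg (ht : Admissible t) (k : ℕ) : 0 ≤ t k := by linarith [ht.half_le k]

theorem comp_add (ht : Admissible t) (m : ℕ) : Admissible fun k => t (m + k) where
  half_le _ := ht.half_le _
  le_one _ := ht.le_one _
  summable := by
    simpa only [add_comm m] using (summable_nat_add_iff (f := fun k => 1 - t k) m).2 ht.summable

end Admissible

/-- The partial products of the Fourier transform of the refinable function of the masks
`blend n (t k)`. -/
noncomputable def partialFT (n : ℕ) (t : ℕ → ℝ) (K : ℕ) (ξ : ℝ) : ℂ :=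
  ∏ j ∈ Finset.range K, symbol n (blend n (t j))
    (Complex.exp (-(Complex.I * ((2 * Real.pi * ξ / 2 ^ (j + 1) : ℝ) : ℂ))))

/-- The Fourier transform `ξ ↦ ∫ f(x) e^{-2πiξx} dx` of the refinable function of the masks
`blend n (t k)`. -/
noncomputable def blendFT (n : ℕ) (t : ℕ → ℝ) (ξ : ℝ) : ℂ :=
  refinableFT n (fun k => blend n (t k)) 0 (2 * Real.pi * ξ)

section

variable {n : ℕ} {t : ℕ → ℝ}

theorem norm_partialFT_le (hn : 1 ≤ n) (ht : Admissible t) (K : ℕ) (ξ : ℝ) :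
    ‖partialFT n t K ξ‖ ≤ ∏ j ∈ Finset.range K, majorant (t j) (2 * Real.pi * ξ / 2 ^ (j + 1)) := by
  rw [partialFT, norm_prod]
  exact Finset.prod_le_prod (fun _ _ => norm_nonneg _) fun j _ =>
    norm_symbol_blend_le hn (ht.nonneg j) (ht.le_one j) _

theorem norm_partialFT_le_one (hn : 1 ≤ n) (ht : Admissible t) (K : ℕ) (ξ : ℝ) :
    ‖partialFT n t K ξ‖ ≤ 1 :=
  (norm_partialFT_le hn ht K ξ).trans <| Finset.prod_le_one
    (fun j _ => majorant_nonneg (ht.nonneg j) (ht.le_one j) _)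
    fun j _ => majorant_le_one (ht.nonneg j) _

theorem hasProd_blendFT (hn : 1 ≤ n) (ht : Admissible t) (ξ : ℝ) :
    HasProd (fun j : ℕ => symbol n (blend n (t j))
      (Complex.exp (-(Complex.I * ((2 * Real.pi * ξ / 2 ^ (j + 1) : ℝ) : ℂ)))))
      (blendFT n t ξ) := by
  set u : ℕ → ℂ := fun j => symbol n (blend n (t j))
    (Complex.exp (-(Complex.I * ((2 * Real.pi * ξ / 2 ^ (j + 1) : ℝ) : ℂ))))
  have hu : Multipliable fun j => 1 + (u j - 1) := by
    apply multipliable_one_add_of_summable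
    refine Summable.of_nonneg_of_le
      (f := fun j : ℕ => (n + 1) * |2 * Real.pi * ξ| * (1 / 2) ^ (j + 1))
      (fun _ => norm_nonneg _) (fun j => ?_) ?_
    · have h := norm_symbol_sub_le (blend_nonneg n (ht.nonneg j) (ht.le_one j)) (sum_blend hn (t j))
        (2 * Real.pi * ξ / 2 ^ (j + 1)) 0
      simp only [Complex.ofReal_zero, mul_zero, neg_zero, Complex.exp_zero,
        symbol_blend_one hn, sub_zero] at h
      refine h.trans_eq ?_
      rw [abs_div, abs_of_pos (by positivity : (0 : ℝ) < 2 ^ (j + 1)), one_div, inv_pow]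
      ring
    · exact ((summable_nat_add_iff 1).2
        (summable_geometric_of_lt_one (by norm_num) (by norm_num : (1 / 2 : ℝ) < 1))).mul_left _
  simp only [add_sub_cancel] at hu
  have h : blendFT n t ξ = ∏' j, u j := by
    unfold blendFT refinableFT
    refine tprod_congr fun j => ?_
    simp only [u, zero_add]
    push_cast
    ring_nf
  rw [h]
  exact hu.hasProd

theorem tendsto_partialFT (hn : 1 ≤ n) (ht : Admissible t) (ξ : ℝ) :
    Tendsto (fun K => partialFT n t K ξ) atTop (𝓝 (blendFT n t ξ)) :=
  (hasProd_blendFT hn ht ξ).tendsto_prod_nat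

/-- The factor 1 - 2^(-K) is the partial sum of the Lipschitz constants 2^(-(j+1)) of the arguments.
The resulting bound is uniform in K, so the limit is Lipschitz. -/
theorem norm_partialFT_sub_le (hn : 1 ≤ n) (ht : Admissible t) (K : ℕ) (ξ η : ℝ) :
    ‖partialFT n t K ξ - partialFT n t K η‖ ≤
      (n + 1) * (2 * Real.pi) * |ξ - η| * (1 - 1 / 2 ^ K) := by
  induction K with
  | zero => simp [partialFT]
  | succ K ih =>
    set u : ℝ → ℂ := fun ξ => symbol n (blend n (t K))
      (Complex.exp (-(Complex.I * ((2 * Real.pi * ξ / 2 ^ (K + 1) : ℝ) : ℂ))))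
    have hs : ∀ ξ, partialFT n t (K + 1) ξ = partialFT n t K ξ * u ξ := fun ξ =>
      Finset.prod_range_succ _ _
    have hu : ‖u ξ‖ ≤ 1 := (norm_symbol_blend_le hn (ht.nonneg K) (ht.le_one K) _).trans
      (majorant_le_one (ht.nonneg K) _)
    have huv : ‖u ξ - u η‖ ≤ (n + 1) * (2 * Real.pi) * |ξ - η| * (1 / 2 ^ (K + 1)) := by
      refine (norm_symbol_sub_le (blend_nonneg n (ht.nonneg K) (ht.le_one K))
        (sum_blend hn (t K)) _ _).trans_eq ?_
      rw [← sub_div, ← mul_sub, abs_div, abs_mul, abs_of_pos Real.two_pi_pos,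
        abs_of_pos (by positivity : (0 : ℝ) < 2 ^ (K + 1))]
      ring
    have hp := norm_partialFT_le_one hn ht K η
    have h : partialFT n t (K + 1) ξ - partialFT n t (K + 1) η =
        (partialFT n t K ξ - partialFT n t K η) * u ξ + partialFT n t K η * (u ξ - u η) := by
      rw [hs, hs]; ring
    rw [h]
    calc _ ≤ ‖partialFT n t K ξ - partialFT n t K η‖ * 1 + 1 * ‖u ξ - u η‖ := by
          refine (norm_add_le _ _).trans ?_
          rw [norm_mul, norm_mul]
          gcongr
      _ ≤ _ := by
          have e : (1 : ℝ) / 2 ^ K = 2 * (1 / 2 ^ (K + 1)) := by rw [pow_succ]; field_simp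
          rw [e] at ih
          nlinarith

theorem continuous_blendFT (hn : 1 ≤ n) (ht : Admissible t) : Continuous (blendFT n t) := by
  have h : ∀ ξ η, dist (blendFT n t ξ) (blendFT n t η) ≤ (n + 1) * (2 * Real.pi) * dist ξ η := by
    intro ξ η
    rw [dist_eq_norm, Real.dist_eq]
    refine le_of_tendsto ((tendsto_partialFT hn ht ξ).sub (tendsto_partialFT hn ht η)).norm
      (Eventually.of_forall fun K => (norm_partialFT_sub_le hn ht K ξ η).trans ?_)
    have : (0 : ℝ) ≤ 1 / 2 ^ K := by positivity
    exact mul_le_of_le_one_right (by positivity) (by linarith)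
  exact (LipschitzWith.of_dist_le' h).continuous

theorem continuous_partialFT (hn : 1 ≤ n) (ht : Admissible t) (K : ℕ) :
    Continuous (partialFT n t K) := by
  have h : ∀ ξ η, dist (partialFT n t K ξ) (partialFT n t K η) ≤
      (n + 1) * (2 * Real.pi) * dist ξ η := by
    intro ξ η
    rw [dist_eq_norm, Real.dist_eq]
    have : (0 : ℝ) ≤ 1 / 2 ^ K := by positivity
    exact (norm_partialFT_sub_le hn ht K ξ η).trans
      (mul_le_of_le_one_right (by positivity) (by linarith))
  exact (LipschitzWith.of_dist_le' h).continuous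

theorem blendFT_zero (hn : 1 ≤ n) (ht : Admissible t) : blendFT n t 0 = 1 := by
  refine tendsto_nhds_unique (tendsto_partialFT hn ht 0) ?_
  simp [partialFT, symbol_blend_one hn]

/-- If l = 2^k r with r odd, the factor of index k is the symbol at exp(-iπr) = -1. -/
theorem blendFT_intCast (hn : 2 ≤ n) (ht : Admissible t) {l : ℤ} (hl : l ≠ 0) :
    blendFT n t l = 0 := by
  obtain ⟨k, r, hr, rfl⟩ : ∃ (k : ℕ) (r : ℤ), Odd r ∧ l = 2 ^ k * r := by
    obtain ⟨r, h, hr⟩ := FiniteMultiplicity.exists_eq_pow_mul_and_not_dvd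
      (Int.finiteMultiplicity_iff.2 ⟨by norm_num, hl⟩ : FiniteMultiplicity (2 : ℤ) l)
    exact ⟨_, r, Int.not_even_iff_odd.1 fun h' => hr (even_iff_two_dvd.1 h'), h⟩
  refine tendsto_nhds_unique (tendsto_partialFT (by omega) ht _)
    (tendsto_const_nhds.congr' ?_)
  filter_upwards [eventually_gt_atTop k] with K hK
  symm
  refine Finset.prod_eq_zero (Finset.mem_range.2 hK) ?_
  rw [← symbol_blend_neg_one hn (t k)]
  congr 1
  have h : -(Complex.I * ((2 * Real.pi * ((2 ^ k * r : ℤ) : ℝ) / 2 ^ (k + 1) : ℝ) : ℂ)) =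
      (-r : ℤ) * (Real.pi * Complex.I) := by
    push_cast
    rw [pow_succ]
    field_simp
  rw [h, Complex.exp_int_mul, Complex.exp_pi_mul_I, Odd.neg_one_zpow hr.neg]

theorem continuous_prod_majorant (t : ℕ → ℝ) (K : ℕ) :
    Continuous fun ξ : ℝ =>
      ∏ j ∈ Finset.range K, majorant (t j) (2 * Real.pi * ξ / 2 ^ (j + 1)) := by
  unfold majorant; fun_prop

theorem periodic_prod_majorant (t : ℕ → ℝ) (K : ℕ) :
    Function.Periodic (fun ξ : ℝ =>
      ∏ j ∈ Finset.range K, majorant (t j) (2 * Real.pi * ξ / 2 ^ (j + 1))) (2 ^ K) := by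
  intro ξ
  refine Finset.prod_congr rfl fun j hj => ?_
  obtain ⟨d, rfl⟩ : ∃ d, K = j + 1 + d := ⟨K - (j + 1), by
    have := Finset.mem_range.1 hj
    omega⟩
  have h : 2 * Real.pi * (ξ + 2 ^ (j + 1 + d)) / 2 ^ (j + 1) =
      2 * Real.pi * ξ / 2 ^ (j + 1) + (2 ^ d : ℕ) * (2 * Real.pi) := by
    rw [pow_add]; push_cast; field_simp
  rw [h, majorant, Real.cos_add_nat_mul_two_pi, majorant]

/-- The interval [0, 2^(K+1)] is folded in half. The first K factors have period 2^K, while the last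
one is shifted by π, and its two values add up to the constant 2 - t K. -/
theorem integral_prod_majorant (t : ℕ → ℝ) (K : ℕ) :
    ∫ ξ in (0 : ℝ)..2 ^ K, ∏ j ∈ Finset.range K, majorant (t j) (2 * Real.pi * ξ / 2 ^ (j + 1)) =
      ∏ j ∈ Finset.range K, (2 - t j) := by
  induction K with
  | zero => simp
  | succ K ih =>
    set P : ℕ → ℝ → ℝ := fun K ξ =>
      ∏ j ∈ Finset.range K, majorant (t j) (2 * Real.pi * ξ / 2 ^ (j + 1))
    have hP : ∀ K, Continuous (P K) := continuous_prod_majorant t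
    have hs : ∀ ξ, P (K + 1) ξ + P (K + 1) (ξ + 2 ^ K) = (2 - t K) * P K ξ := by
      intro ξ
      have hp : P K (ξ + 2 ^ K) = P K ξ := periodic_prod_majorant t K ξ
      have h : 2 * Real.pi * (ξ + 2 ^ K) / 2 ^ (K + 1) =
          2 * Real.pi * ξ / 2 ^ (K + 1) + Real.pi := by
        rw [pow_succ]; field_simp
      have e : ∀ ξ, P (K + 1) ξ = P K ξ * majorant (t K) (2 * Real.pi * ξ / 2 ^ (K + 1)) :=
        fun ξ => Finset.prod_range_succ _ _
      rw [e, e, hp, h, ← mul_add, majorant_add_pi, mul_comm]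
    have h1 : ∫ ξ in (0 : ℝ)..2 ^ K, P (K + 1) (ξ + 2 ^ K) =
        ∫ ξ in (2 : ℝ) ^ K..2 ^ (K + 1), P (K + 1) ξ := by
      rw [intervalIntegral.integral_comp_add_right, zero_add, pow_succ, mul_two]
    have hi : ∀ a b, IntervalIntegrable (P (K + 1)) volume a b := fun a b =>
      (hP (K + 1)).intervalIntegrable a b
    have hi' : IntervalIntegrable (fun ξ => P (K + 1) (ξ + 2 ^ K)) volume 0 (2 ^ K) :=
      ((hP (K + 1)).comp (continuous_add_const _)).intervalIntegrable _ _
    calc ∫ ξ in (0 : ℝ)..2 ^ (K + 1), P (K + 1) ξ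
        = ∫ ξ in (0 : ℝ)..2 ^ K, (P (K + 1) ξ + P (K + 1) (ξ + 2 ^ K)) := by
          rw [intervalIntegral.integral_add (hi _ _) hi', h1,
            intervalIntegral.integral_add_adjacent_intervals (hi _ _) (hi _ _)]
      _ = (2 - t K) * ∫ ξ in (0 : ℝ)..2 ^ K, P K ξ := by
          simp only [hs, intervalIntegral.integral_const_mul]
      _ = _ := by rw [ih, Finset.prod_range_succ, mul_comm]

theorem prod_two_sub_le (ht : Admissible t) (K : ℕ) :
    ∏ j ∈ Finset.range K, (2 - t j) ≤ Real.exp (∑' j, (1 - t j)) := by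
  calc ∏ j ∈ Finset.range K, (2 - t j) ≤ ∏ j ∈ Finset.range K, Real.exp (1 - t j) := by
        refine Finset.prod_le_prod (fun j _ => by linarith [ht.le_one j]) fun j _ => ?_
        linarith [Real.add_one_le_exp (1 - t j)]
    _ ≤ _ := by
        rw [← Real.exp_sum]
        exact Real.exp_le_exp.2 (ht.summable.sum_le_tsum _ fun j _ => by linarith [ht.le_one j])

theorem norm_blendFT_le (hn : 1 ≤ n) (ht : Admissible t) (K : ℕ) (ξ : ℝ) :
    ‖blendFT n t ξ‖ ≤ ∏ j ∈ Finset.range K, majorant (t j) (2 * Real.pi * ξ / 2 ^ (j + 1)) := by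
  refine le_of_tendsto (tendsto_partialFT hn ht ξ).norm ?_
  filter_upwards [eventually_ge_atTop K] with L hL
  refine (norm_partialFT_le hn ht L ξ).trans ?_
  obtain ⟨d, rfl⟩ := Nat.exists_eq_add_of_le hL
  rw [Finset.prod_range_add]
  refine mul_le_of_le_one_right (Finset.prod_nonneg fun j _ =>
    majorant_nonneg (ht.nonneg j) (ht.le_one j) _) (Finset.prod_le_one (fun j _ =>
    majorant_nonneg (ht.nonneg _) (ht.le_one _) _) fun j _ => majorant_le_one (ht.nonneg _) _)

theorem intervalIntegral_norm_blendFT_le (hn : 1 ≤ n) (ht : Admissible t) (K : ℕ) :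
    ∫ ξ in (-2 ^ K : ℝ)..2 ^ K, ‖blendFT n t ξ‖ ≤ 2 * Real.exp (∑' j, (1 - t j)) := by
  have hK : (0 : ℝ) < 2 ^ K := by positivity
  have hc := continuous_prod_majorant t K
  -- The interval [-2^K, 2^K] consists of two periods, whence the factor 2.
  have hp := (periodic_prod_majorant t K).intervalIntegral_add_eq (-2 ^ K) 0
  rw [neg_add_cancel, zero_add, integral_prod_majorant] at hp
  calc _ ≤ ∫ ξ in (-2 ^ K : ℝ)..2 ^ K,
          ∏ j ∈ Finset.range K, majorant (t j) (2 * Real.pi * ξ / 2 ^ (j + 1)) :=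
        intervalIntegral.integral_mono_on (by linarith)
          ((continuous_blendFT hn ht).norm.intervalIntegrable _ _) (hc.intervalIntegrable _ _)
          fun ξ _ => norm_blendFT_le hn ht K ξ
    _ = 2 * ∏ j ∈ Finset.range K, (2 - t j) := by
        rw [← intervalIntegral.integral_add_adjacent_intervals (b := 0)
          (hc.intervalIntegrable _ _) (hc.intervalIntegrable _ _), hp, integral_prod_majorant]
        ring
    _ ≤ _ := mul_le_mul_of_nonneg_left (prod_two_sub_le ht K) two_pos.le

theorem tendsto_two_pow_atTop : Tendsto (fun K : ℕ => (2 : ℝ) ^ K) atTop atTop :=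
  tendsto_pow_atTop_atTop_of_one_lt one_lt_two

theorem integrable_blendFT (hn : 1 ≤ n) (ht : Admissible t) : Integrable (blendFT n t) :=
  integrable_of_intervalIntegral_norm_bounded _
    (fun _ => ((continuous_blendFT hn ht).integrableOn_Icc).mono_set Set.Ioc_subset_Icc_self)
    (tendsto_neg_atTop_atBot.comp tendsto_two_pow_atTop) tendsto_two_pow_atTop
    (Eventually.of_forall (intervalIntegral_norm_blendFT_le hn ht))

theorem integral_norm_blendFT_le (hn : 1 ≤ n) (ht : Admissible t) :
    ∫ ξ, ‖blendFT n t ξ‖ ≤ 2 * Real.exp (∑' j, (1 - t j)) :=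
  le_of_tendsto (intervalIntegral_tendsto_integral (integrable_blendFT hn ht).norm
    (tendsto_neg_atTop_atBot.comp tendsto_two_pow_atTop) tendsto_two_pow_atTop)
    (Eventually.of_forall (intervalIntegral_norm_blendFT_le hn ht))

end

/-! ### Compact support and partition of unity -/

section

variable {n : ℕ} {t : ℕ → ℝ}

/-- A partial product is the Fourier transform of a finite discrete measure. The factor j moves the
nodes by at most (n+1)/2^(j+1), and these shifts sum to (n+1)(1 - 2^(-K)). -/
theorem exists_partialFT_eq_sum (hn : 1 ≤ n) (t : ℕ → ℝ) (K : ℕ) :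
    ∃ (ι : Type) (_ : Fintype ι) (w : ι → ℂ) (x : ι → ℝ),
      (∀ i, x i ∈ Set.Icc (0 : ℝ) ((n + 1) * (1 - 1 / 2 ^ K))) ∧
      ∀ ξ, partialFT n t K ξ =
        ∑ i, w i * Complex.exp (((-2 * Real.pi * ξ * x i : ℝ) : ℂ) * Complex.I) := by
  induction K with
  | zero => exact ⟨Unit, inferInstance, fun _ => 1, fun _ => 0, by simp, by simp [partialFT]⟩
  | succ K ih =>
    obtain ⟨ι, _, w, x, hx, h⟩ := ih
    refine ⟨ι × Finset.Icc (0 : ℤ) (n + 1), inferInstance, fun p => w p.1 * blend n (t K) p.2,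
      fun p => x p.1 + ((p.2 : ℤ) : ℝ) / 2 ^ (K + 1), ?_, fun ξ => ?_⟩
    · rintro ⟨i, α, hα⟩
      obtain ⟨h0, h1⟩ := hx i
      obtain ⟨hα0, hα1⟩ := Finset.mem_Icc.1 hα
      have hα0' : (0 : ℝ) ≤ (α : ℝ) / 2 ^ (K + 1) := by
        have : (0 : ℝ) ≤ α := by exact_mod_cast hα0
        positivity
      have hα1' : (α : ℝ) / 2 ^ (K + 1) ≤ (n + 1) / 2 ^ (K + 1) := by
        have : (α : ℝ) ≤ n + 1 := by exact_mod_cast hα1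
        gcongr
      have e : ((n : ℝ) + 1) * (1 - 1 / 2 ^ K) + (n + 1) / 2 ^ (K + 1) =
          (n + 1) * (1 - 1 / 2 ^ (K + 1)) := by
        rw [pow_succ]; field_simp; ring
      exact ⟨add_nonneg h0 hα0', by linarith⟩
    · rw [partialFT, Finset.prod_range_succ, ← partialFT, h, symbol,
        ← Finset.sum_coe_sort (Finset.Icc (0 : ℤ) (n + 1)), Fintype.sum_mul_sum, Fintype.sum_prod_type]
      refine Finset.sum_congr rfl fun i _ => Finset.sum_congr rfl fun α _ => ?_
      rw [cexp_neg_I_mul_zpow, mul_mul_mul_comm, ← Complex.exp_add]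
      congr 2
      push_cast
      rw [pow_succ]
      field_simp
      ring

theorem integral_partialFT_mul_fourierInv (hn : 1 ≤ n) (t : ℕ → ℝ) (K : ℕ)
    (g : SchwartzMap ℝ ℂ) (hg : ∀ x ∈ Set.Icc (0 : ℝ) (n + 1), g x = 0) :
    ∫ ξ, partialFT n t K ξ * 𝓕⁻ (g : ℝ → ℂ) ξ = 0 := by
  obtain ⟨ι, _, w, x, hx, h⟩ := exists_partialFT_eq_sum hn t K
  have hgi : Integrable (𝓕⁻ (g : ℝ → ℂ)) := by
    rw [← SchwartzMap.fourierInv_coe]; exact SchwartzMap.integrable _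
  have key : ∀ y : ℝ, Integrable (fun ξ : ℝ =>
      Complex.exp (((-2 * Real.pi * ξ * y : ℝ) : ℂ) * Complex.I) * 𝓕⁻ (g : ℝ → ℂ) ξ) ∧
      ∫ ξ : ℝ, Complex.exp (((-2 * Real.pi * ξ * y : ℝ) : ℂ) * Complex.I) *
        𝓕⁻ (g : ℝ → ℂ) ξ = g y := by
    intro y
    constructor
    · refine hgi.bdd_mul (c := 1) (by fun_prop) (Eventually.of_forall fun ξ => ?_)
      rw [Complex.norm_exp_ofReal_mul_I]
    · have h1 := Real.fourier_real_eq_integral_exp_smul (𝓕⁻ (g : ℝ → ℂ)) y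
      simp only [smul_eq_mul] at h1
      rw [← h1, ← SchwartzMap.fourierInv_coe, ← SchwartzMap.fourier_coe,
        FourierTransform.fourier_fourierInv_eq]
  simp only [h, Finset.sum_mul, mul_assoc (w _)]
  rw [integral_finsetSum _ fun i _ => (key (x i)).1.const_mul (w i)]
  refine Finset.sum_eq_zero fun i _ => ?_
  rw [integral_const_mul, (key (x i)).2, hg, mul_zero]
  obtain ⟨h0, h1⟩ := hx i
  refine ⟨h0, h1.trans (mul_le_of_le_one_right (by positivity) ?_)⟩
  have : (0 : ℝ) ≤ 1 / 2 ^ K := by positivity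
  linarith

theorem integral_blendFT_mul_fourierInv (hn : 1 ≤ n) (ht : Admissible t)
    (g : SchwartzMap ℝ ℂ) (hg : ∀ x ∈ Set.Icc (0 : ℝ) (n + 1), g x = 0) :
    ∫ ξ, blendFT n t ξ * 𝓕⁻ (g : ℝ → ℂ) ξ = 0 := by
  have hgi : Integrable (𝓕⁻ (g : ℝ → ℂ)) := by
    rw [← SchwartzMap.fourierInv_coe]; exact SchwartzMap.integrable _
  have h := tendsto_integral_of_dominated_convergence (F := fun K ξ =>
    partialFT n t K ξ * 𝓕⁻ (g : ℝ → ℂ) ξ) (f := fun ξ => blendFT n t ξ * 𝓕⁻ (g : ℝ → ℂ) ξ)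
    (fun ξ => ‖𝓕⁻ (g : ℝ → ℂ) ξ‖)
    (fun K => (continuous_partialFT hn ht K).aestronglyMeasurable.mul hgi.aestronglyMeasurable)
    hgi.norm (fun K => Eventually.of_forall fun ξ => by
      rw [norm_mul]
      exact mul_le_of_le_one_left (norm_nonneg _) (norm_partialFT_le_one hn ht K ξ))
    (Eventually.of_forall fun ξ => (tendsto_partialFT hn ht ξ).mul_const _)
  simp only [integral_partialFT_mul_fourierInv hn t _ g hg] at h
  exact tendsto_nhds_unique h tendsto_const_nhds

theorem integral_fourierInv_mul {f g : ℝ → ℂ} (hf : Integrable f) (hg : Integrable g) :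
    ∫ x, 𝓕⁻ f x * g x = ∫ x, f x * 𝓕⁻ g x := by
  have hL : (-innerₗ ℝ).flip = -innerₗ ℝ := by ext; simp
  have h := VectorFourier.integral_fourierIntegral_smul_eq_flip (L := -innerₗ ℝ)
    Real.continuous_fourierChar (continuous_inner (𝕜 := ℝ) (E := ℝ)).neg hf hg
  rw [hL] at h
  exact h

theorem continuous_fourierInv_of_integrable {f : ℝ → ℂ} (hf : Integrable f) :
    Continuous (𝓕⁻ f) :=
  VectorFourier.fourierIntegral_continuous (L := -innerₗ ℝ) Real.continuous_fourierChar
    (continuous_inner.neg) hf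

theorem norm_fourierInv_le (f : ℝ → ℂ) (x : ℝ) : ‖𝓕⁻ f x‖ ≤ ∫ ξ, ‖f ξ‖ :=
  VectorFourier.norm_fourierIntegral_le_integral_norm _ _ _ _ _

theorem continuous_fourierInv_blendFT (hn : 1 ≤ n) (ht : Admissible t) :
    Continuous (𝓕⁻ (blendFT n t)) :=
  continuous_fourierInv_of_integrable (integrable_blendFT hn ht)

/-- Paired with a test function vanishing on [0, n+1], the partial products give zero, and so does
their limit. Continuity turns vanishing almost everywhere outside the interval into vanishing
everywhere, endpoints included; this makes the window of coefficients exact. -/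
theorem fourierInv_blendFT_eq_zero (hn : 1 ≤ n) (ht : Admissible t) {x : ℝ}
    (hx : x ∉ Set.Ioo (0 : ℝ) (n + 1)) : 𝓕⁻ (blendFT n t) x = 0 := by
  have hc := continuous_fourierInv_blendFT hn ht
  set U : Set ℝ := (Set.Icc (0 : ℝ) (n + 1))ᶜ
  have hU : IsOpen U := isClosed_Icc.isOpen_compl
  have hae := hU.ae_eq_zero_of_integral_contDiff_smul_eq_zero
    (f := 𝓕⁻ (blendFT n t)) (μ := volume) (hc.locallyIntegrable.locallyIntegrableOn U)
    fun g hg hgc hgU => by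
      set G : SchwartzMap ℝ ℂ := (hgc.comp_left (g := ((↑) : ℝ → ℂ)) rfl).toSchwartzMap
        (Complex.ofRealCLM.contDiff.comp hg)
      have hG : ∀ x, G x = g x := fun _ => rfl
      have h0 : ∀ x ∈ Set.Icc (0 : ℝ) (n + 1), G x = 0 := by
        intro x hx
        rw [hG, image_eq_zero_of_notMem_tsupport fun h => hgU h hx, Complex.ofReal_zero]
      have h1 := integral_blendFT_mul_fourierInv hn ht G h0
      rw [← integral_fourierInv_mul (integrable_blendFT hn ht) G.integrable] at h1
      rw [← h1]
      refine integral_congr_ae (Eventually.of_forall fun x => ?_)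
      simp only [hG, Complex.real_smul, mul_comm]
  have hUz : ∀ y ∈ U, 𝓕⁻ (blendFT n t) y = 0 := by
    have h1 : 𝓕⁻ (blendFT n t) =ᵐ[volume.restrict U] fun _ => 0 :=
      (ae_restrict_iff' hU.measurableSet).2 hae
    exact Measure.eqOn_open_of_ae_eq h1 hU hc.continuousOn continuousOn_const
  have hcl : closure U ⊆ {y | 𝓕⁻ (blendFT n t) y = 0} :=
    closure_minimal hUz (isClosed_eq hc continuous_const)
  apply hcl
  rw [closure_compl, interior_Icc]
  exact hx

theorem hasCompactSupport_fourierInv_blendFT (hn : 1 ≤ n) (ht : Admissible t) :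
    HasCompactSupport (𝓕⁻ (blendFT n t)) :=
  HasCompactSupport.intro isCompact_Icc fun _ hx =>
    fourierInv_blendFT_eq_zero hn ht fun h => hx (Set.Ioo_subset_Icc_self h)

theorem fourier_fourierInv_blendFT (hn : 1 ≤ n) (ht : Admissible t) :
    𝓕 (𝓕⁻ (blendFT n t)) = blendFT n t := by
  have hc := continuous_fourierInv_blendFT hn ht
  have hi : Integrable (𝓕⁻ (blendFT n t)) :=
    hc.integrable_of_hasCompactSupport (hasCompactSupport_fourierInv_blendFT hn ht)
  refine (continuous_blendFT hn ht).fourier_fourierInv_eq (integrable_blendFT hn ht) ?_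
  refine hi.comp_neg.congr (Eventually.of_forall fun w => ?_)
  simp only [Real.fourierInv_eq_fourier_neg, neg_neg]

theorem integral_fourierInv_blendFT (hn : 1 ≤ n) (ht : Admissible t) :
    ∫ x, 𝓕⁻ (blendFT n t) x = 1 := by
  rw [← blendFT_zero hn ht, ← fourier_fourierInv_blendFT hn ht, Real.fourier_real_eq]
  simp only [mul_zero, neg_zero, AddChar.map_zero_eq_one, one_smul,
    fourier_fourierInv_blendFT hn ht]

/-- Poisson summation: among the integer frequencies only 0 contributes. -/
theorem tsum_fourierInv_blendFT (hn : 2 ≤ n) (ht : Admissible t) (x : ℝ) :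
    ∑' k : ℤ, 𝓕⁻ (blendFT n t) (x + k) = 1 := by
  have hn1 : 1 ≤ n := by omega
  have h0 : ∀ l : ℤ, l ≠ 0 → 𝓕 (𝓕⁻ (blendFT n t)) (l : ℝ) = 0 := fun l hl => by
    rw [fourier_fourierInv_blendFT hn1 ht, blendFT_intCast hn ht hl]
  rw [Real.tsum_eq_tsum_fourier_of_rpow_decay_of_summable
    (continuous_fourierInv_blendFT hn1 ht) one_lt_two ?_ ?_ x]
  · rw [tsum_eq_single 0 fun l hl => by rw [h0 l hl, zero_mul], fourier_fourierInv_blendFT hn1 ht]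
    simp [blendFT_zero hn1 ht]
  · refine Filter.EventuallyEq.trans_isBigO ?_ (Asymptotics.isBigO_zero _ _)
    filter_upwards [(isCompact_Icc (a := (0 : ℝ)) (b := n + 1)).compl_mem_cocompact] with y hy
    exact fourierInv_blendFT_eq_zero hn1 ht fun h => hy (Set.Ioo_subset_Icc_self h)
  · exact summable_of_ne_finset_zero (s := {0}) fun l hl => h0 l (by simpa using hl)

end

/-! ### Rescaling every level to level 0 -/

theorem refinableFT_eq_comp_add (n : ℕ) (a : ℕ → ℤ → ℝ) (m : ℕ) (ω : ℝ) :
    refinableFT n a m ω = refinableFT n (fun k => a (m + k)) 0 (ω / 2 ^ m) := by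
  refine tprod_congr fun j => ?_
  simp only [zero_add]
  congr 3
  push_cast
  rw [add_assoc m j 1, pow_add]
  field_simp

theorem refinable_eq_comp_add (n : ℕ) (a : ℕ → ℤ → ℝ) (m : ℕ) (x : ℝ) :
    refinable n a m x = 2 ^ m * refinable n (fun k => a (m + k)) 0 (2 ^ m * x) := by
  have h : 𝓕⁻ (fun ξ : ℝ => refinableFT n a m (2 * Real.pi * ξ)) x = (2 ^ m : ℝ) •
      𝓕⁻ (fun ξ : ℝ => refinableFT n (fun k => a (m + k)) 0 (2 * Real.pi * ξ)) (2 ^ m * x) := by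
    have hm : (0 : ℝ) < 2 ^ m := by positivity
    rw [Real.fourierInv_eq, Real.fourierInv_eq]
    have h := Measure.integral_comp_div (fun η : ℝ => Real.fourierChar (inner ℝ η (2 ^ m * x)) •
      refinableFT n (fun k => a (m + k)) 0 (2 * Real.pi * η)) (2 ^ m)
    rw [abs_of_pos hm] at h
    rw [← h]
    refine integral_congr_ae (Eventually.of_forall fun ξ => ?_)
    simp only [RCLike.inner_apply, conj_trivial]
    rw [refinableFT_eq_comp_add]
    rw [show (2 : ℝ) ^ m * x * (ξ / 2 ^ m) = x * ξ by field_simp, mul_div_assoc]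
  rw [refinable, h, Complex.smul_re, refinable, smul_eq_mul]

theorem prewaveletCoeff_zero (n : ℕ) (a : ℕ → ℤ → ℝ) (α : ℤ) :
    prewaveletCoeff n a 0 α =
      2 * ∫ x, refinable n a 0 x * refinable n (fun k => a (1 + k)) 0 (2 * x + α) := by
  rw [prewaveletCoeff, pow_zero, div_one, one_mul, ← integral_const_mul]
  refine integral_congr_ae (Eventually.of_forall fun x => ?_)
  simp only [zero_add, refinable_eq_comp_add n a 1, pow_one]
  rw [show (2 : ℝ) * (x + α / 2) = 2 * x + α by ring]
  ring

theorem prewaveletCoeff_eq_comp_add (n : ℕ) (a : ℕ → ℤ → ℝ) (m : ℕ) (α : ℤ) :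
    prewaveletCoeff n a m α = prewaveletCoeff n (fun k => a (m + k)) 0 α := by
  have hm : (0 : ℝ) < 2 ^ m := by positivity
  rw [prewaveletCoeff_zero, prewaveletCoeff]
  set g : ℝ → ℝ := fun y => refinable n (fun k => a (m + k)) 0 y *
    refinable n (fun k => a (m + (1 + k))) 0 (2 * y + α)
  have h : ∀ x : ℝ, refinable n a m x * refinable n a (m + 1) (x + α / 2 ^ (m + 1)) =
      2 ^ m * 2 ^ (m + 1) * g (2 ^ m * x) := by
    intro x
    simp only [g, refinable_eq_comp_add n a m, refinable_eq_comp_add n a (m + 1), add_assoc]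
    rw [show (2 : ℝ) ^ (m + 1) * (x + α / 2 ^ (m + 1)) = 2 * (2 ^ m * x) + α by
      rw [pow_succ]; field_simp]
    ring
  simp only [h]
  rw [integral_const_mul, Measure.integral_comp_mul_left g, abs_of_pos (by positivity), smul_eq_mul]
  rw [pow_succ]
  field_simp

/-! ### Refinement equation and prewavelet coefficients -/

/-- The refinable function of the masks `blend n (t k)`. -/
noncomputable def blendFun (n : ℕ) (t : ℕ → ℝ) (x : ℝ) : ℝ :=
  refinable n (fun k => blend n (t k)) 0 x

section

variable {n : ℕ} {t : ℕ → ℝ}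

theorem blendFun_eq (n : ℕ) (t : ℕ → ℝ) (x : ℝ) : blendFun n t x = (𝓕⁻ (blendFT n t) x).re := rfl

theorem continuous_blendFun (hn : 1 ≤ n) (ht : Admissible t) : Continuous (blendFun n t) :=
  Complex.continuous_re.comp (continuous_fourierInv_blendFT hn ht)

theorem blendFun_eq_zero (hn : 1 ≤ n) (ht : Admissible t) {x : ℝ}
    (hx : x ∉ Set.Ioo (0 : ℝ) (n + 1)) : blendFun n t x = 0 := by
  rw [blendFun_eq, fourierInv_blendFT_eq_zero hn ht hx, Complex.zero_re]

theorem integrable_fourierInv_blendFT (hn : 1 ≤ n) (ht : Admissible t) :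
    Integrable (𝓕⁻ (blendFT n t)) :=
  (continuous_fourierInv_blendFT hn ht).integrable_of_hasCompactSupport
    (hasCompactSupport_fourierInv_blendFT hn ht)

theorem integrable_blendFun (hn : 1 ≤ n) (ht : Admissible t) : Integrable (blendFun n t) :=
  (integrable_fourierInv_blendFT hn ht).re

theorem abs_blendFun_le (hn : 1 ≤ n) (ht : Admissible t) (x : ℝ) :
    |blendFun n t x| ≤ 2 * Real.exp (∑' j, (1 - t j)) :=
  ((Complex.abs_re_le_norm _).trans (norm_fourierInv_le _ _)).trans
    (integral_norm_blendFT_le hn ht)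

theorem integral_blendFun (hn : 1 ≤ n) (ht : Admissible t) : ∫ x, blendFun n t x = 1 := by
  have h := integral_re (𝕜 := ℂ) (integrable_fourierInv_blendFT hn ht)
  rw [integral_fourierInv_blendFT hn ht] at h
  exact h.trans RCLike.one_re

theorem sum_blendFun (hn : 2 ≤ n) (ht : Admissible t) (x : ℝ) (A : Finset ℤ)
    (hA : ∀ k : ℤ, x + k ∈ Set.Ioo (0 : ℝ) (n + 1) → k ∈ A) :
    ∑ k ∈ A, blendFun n t (x + k) = 1 := by
  have h := tsum_fourierInv_blendFT hn ht x
  rw [tsum_eq_sum (s := A) fun k hk =>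
    fourierInv_blendFT_eq_zero (by omega) ht fun h => hk (hA k h)] at h
  simp only [blendFun_eq, ← Complex.re_sum, h, Complex.one_re]

theorem refinableFT_zero_eq (hn : 1 ≤ n) (ht : Admissible t) {a : ℕ → ℤ → ℝ}
    (ha : ∀ k, a (1 + k) = blend n (t k)) (ξ : ℝ) :
    refinableFT n a 0 (2 * Real.pi * ξ) =
      symbol n (a 0) (Complex.exp (-(Complex.I * ((Real.pi * ξ : ℝ) : ℂ)))) *
        blendFT n t (ξ / 2) := by
  set f : ℕ → ℂ := fun j => symbol n (a (0 + j))
    (Complex.exp (-(Complex.I * ((2 * Real.pi * ξ : ℝ) : ℂ) / 2 ^ (0 + j + 1))))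
  have h : HasProd (fun j => f (j + 1)) (blendFT n t (ξ / 2)) := by
    convert hasProd_blendFT hn ht (ξ / 2) using 2 with j
    simp only [f, zero_add, add_comm j 1, ha]
    congr 3
    push_cast
    rw [pow_succ]
    field_simp
  have h0 : f 0 = symbol n (a 0) (Complex.exp (-(Complex.I * ((Real.pi * ξ : ℝ) : ℂ)))) := by
    simp only [f, zero_add, pow_one]
    congr 3
    push_cast
    ring
  rw [← h0]
  exact h.zero_mul.tprod_eq

/-- The first mask is left arbitrary because the mask at level 0 is not a blend. -/
theorem refinable_zero_eq (hn : 1 ≤ n) (ht : Admissible t) {a : ℕ → ℤ → ℝ}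
    (ha : ∀ k, a (1 + k) = blend n (t k)) (x : ℝ) :
    refinable n a 0 x =
      2 * ∑ β ∈ Finset.Icc (0 : ℤ) (n + 1), a 0 β * blendFun n t (2 * x - β) := by
  set F : ℝ → ℝ → ℂ := fun y η => Complex.exp (((2 * Real.pi * (η * y) : ℝ) : ℂ) * Complex.I) *
    blendFT n t η
  have hF : ∀ y, Integrable (F y) := fun y => by
    refine (integrable_blendFT hn ht).bdd_mul (c := 1) (by fun_prop)
      (Eventually.of_forall fun ξ => ?_)
    rw [Complex.norm_exp_ofReal_mul_I]
  have hFi : ∀ y, ∫ η, F y η = 𝓕⁻ (blendFT n t) y := fun y => by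
    rw [Real.fourierInv_eq']
    refine integral_congr_ae (Eventually.of_forall fun ξ => ?_)
    simp only [RCLike.inner_apply, conj_trivial, smul_eq_mul, F, mul_comm y]
  have key : 𝓕⁻ (fun ξ : ℝ => refinableFT n a 0 (2 * Real.pi * ξ)) x =
      ∑ β ∈ Finset.Icc (0 : ℤ) (n + 1),
        ((2 * a 0 β : ℝ) : ℂ) * 𝓕⁻ (blendFT n t) (2 * x - β) := by
    calc _ = ∫ ξ : ℝ, ∑ β ∈ Finset.Icc (0 : ℤ) (n + 1), (a 0 β : ℂ) * F (2 * x - β) (ξ / 2) := by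
          rw [Real.fourierInv_eq']
          refine integral_congr_ae (Eventually.of_forall fun ξ => ?_)
          simp only [RCLike.inner_apply, conj_trivial, smul_eq_mul]
          rw [refinableFT_zero_eq hn ht ha, symbol, Finset.sum_mul, Finset.mul_sum]
          refine Finset.sum_congr rfl fun β _ => ?_
          simp only [F]
          rw [cexp_neg_I_mul_zpow]
          have e : (((2 * Real.pi * (ξ / 2 * (2 * x - β)) : ℝ) : ℂ) * Complex.I) =
              ((2 * Real.pi * (x * ξ) : ℝ) : ℂ) * Complex.I +
                Complex.I * ((-β * (Real.pi * ξ) : ℝ) : ℂ) := by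
            push_cast; ring
          rw [e, Complex.exp_add]
          ring
      _ = _ := by
          rw [integral_finsetSum _ fun β _ => ((hF _).comp_div two_ne_zero).const_mul _]
          refine Finset.sum_congr rfl fun β _ => ?_
          rw [integral_const_mul, Measure.integral_comp_div, hFi, abs_two, Complex.real_smul]
          push_cast
          ring
  rw [refinable, key, Complex.re_sum, Finset.mul_sum]
  refine Finset.sum_congr rfl fun β _ => ?_
  rw [Complex.re_ofReal_mul, blendFun_eq]
  ring

/-- The prewavelet coefficients at level `0` of the masks `blend n (t k)`. -/
noncomputable def blendCoeff (n : ℕ) (t : ℕ → ℝ) (α : ℤ) : ℝ :=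
  prewaveletCoeff n (fun k => blend n (t k)) 0 α

theorem blendCoeff_eq (n : ℕ) (t : ℕ → ℝ) (α : ℤ) :
    blendCoeff n t α = 2 * ∫ x, blendFun n t x * blendFun n (fun k => t (1 + k)) (2 * x + α) :=
  prewaveletCoeff_zero n _ α

theorem integrable_blendFun_mul (hn : 1 ≤ n) (ht : Admissible t) {s : ℕ → ℝ} (hs : Admissible s)
    (c : ℝ) : Integrable fun x => blendFun n t x * blendFun n s (2 * x + c) :=
  (integrable_blendFun hn ht).mul_bdd (c := 2 * Real.exp (∑' j, (1 - s j)))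
    ((continuous_blendFun hn hs).comp
      (by fun_prop : Continuous fun x : ℝ => 2 * x + c)).aestronglyMeasurable
    (Eventually.of_forall fun _ => abs_blendFun_le hn hs _)

theorem blendCoeff_eq_zero (hn : 1 ≤ n) (ht : Admissible t) {α : ℤ} (hα : α ∉ window n) :
    blendCoeff n t α = 0 := by
  have h : ∀ x : ℝ, blendFun n t x * blendFun n (fun k => t (1 + k)) (2 * x + α) = 0 := by
    intro x
    by_cases hx : x ∈ Set.Ioo (0 : ℝ) (n + 1)
    · rw [blendFun_eq_zero (x := 2 * x + α) hn (ht.comp_add 1) ?_, mul_zero]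
      rintro ⟨h0, h1⟩
      apply hα
      obtain ⟨hx0, hx1⟩ := hx
      have h2 : -2 * (n : ℝ) - 2 < α := by linarith
      have h3 : (α : ℝ) < n + 1 := by linarith
      have h2' : -2 * (n : ℤ) - 2 < α := by exact_mod_cast h2
      have h3' : α < (n : ℤ) + 1 := by exact_mod_cast h3
      exact Finset.mem_Icc.2 ⟨by omega, by omega⟩
    · rw [blendFun_eq_zero hn ht hx, zero_mul]
  simp [blendCoeff_eq, h]

theorem sum_blendCoeff (hn : 2 ≤ n) (ht : Admissible t) :
    ∑ α ∈ window n, blendCoeff n t α = 2 := by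
  have hn1 : 1 ≤ n := by omega
  simp only [blendCoeff_eq, ← Finset.mul_sum]
  rw [← integral_finsetSum _ fun α _ => integrable_blendFun_mul hn1 ht (ht.comp_add 1) _]
  have h : ∀ x : ℝ, ∑ α ∈ window n,
      blendFun n t x * blendFun n (fun k => t (1 + k)) (2 * x + α) = blendFun n t x := by
    intro x
    rw [← Finset.mul_sum]
    by_cases hx : x ∈ Set.Ioo (0 : ℝ) (n + 1)
    · rw [sum_blendFun hn (ht.comp_add 1) _ _ ?_, mul_one]
      rintro α ⟨h0, h1⟩
      obtain ⟨hx0, hx1⟩ := hx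
      have h2 : -2 * (n : ℝ) - 2 < α := by linarith
      have h3 : (α : ℝ) < n + 1 := by linarith
      have h2' : -2 * (n : ℤ) - 2 < α := by exact_mod_cast h2
      have h3' : α < (n : ℤ) + 1 := by exact_mod_cast h3
      exact Finset.mem_Icc.2 ⟨by omega, by omega⟩
    · rw [blendFun_eq_zero hn1 ht hx, zero_mul]
  simp only [h, integral_blendFun hn1 ht, mul_one]

theorem tsum_one_sub_comp_add_le (ht : Admissible t) (m : ℕ) :
    ∑' j, (1 - t (m + j)) ≤ ∑' j, (1 - t j) := by
  have h := ht.summable.sum_add_tsum_nat_add m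
  have h0 : 0 ≤ ∑ j ∈ Finset.range m, (1 - t j) :=
    Finset.sum_nonneg fun j _ => by linarith [ht.le_one j]
  simp only [add_comm m]
  linarith

theorem abs_blendCoeff_le (hn : 1 ≤ n) (ht : Admissible t) (α : ℤ) :
    |blendCoeff n t α| ≤ 2 * ((2 * Real.exp (∑' j, (1 - t j))) ^ 2 * (n + 1)) := by
  set B := 2 * Real.exp (∑' j, (1 - t j))
  have hB : 0 ≤ B := by positivity
  have h : ∀ x : ℝ, ‖blendFun n t x * blendFun n (fun k => t (1 + k)) (2 * x + α)‖ ≤ B ^ 2 := by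
    intro x
    rw [norm_mul, sq]
    refine mul_le_mul (abs_blendFun_le hn ht x) ?_ (norm_nonneg _) hB
    refine (abs_blendFun_le hn (ht.comp_add 1) _).trans ?_
    have := tsum_one_sub_comp_add_le ht 1
    simp only [B]
    gcongr
  rw [blendCoeff_eq, abs_mul, abs_two]
  refine mul_le_mul_of_nonneg_left ?_ two_pos.le
  -- The first factor lives on an interval of length n + 1.
  rw [← setIntegral_eq_integral_of_forall_compl_eq_zero (s := Set.Ioo (0 : ℝ) (n + 1))
    fun x hx => by rw [blendFun_eq_zero hn ht hx, zero_mul]]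
  refine (norm_setIntegral_le_of_norm_le_const measure_Ioo_lt_top fun x _ => h x).trans_eq ?_
  rw [Real.volume_real_Ioo_of_le (by positivity), sub_zero]

/-- Both factors are refined, 2x - β is taken as the new variable, and the double sum is reindexed
by δ = 2α + 2β - γ. -/
theorem prewaveletCoeff_zero_eq_sum (hn : 1 ≤ n) (ht : Admissible t) {a : ℕ → ℤ → ℝ}
    (ha : ∀ k, a (1 + k) = blend n (t k)) (α : ℤ) :
    prewaveletCoeff n a 0 α =
      ∑ δ ∈ window n, twoScale n (a 0) (blend n (t 0)) (2 * α - δ) * blendCoeff n t δ := by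
  set s : ℕ → ℝ := fun k => t (1 + k)
  have hs : Admissible s := ht.comp_add 1
  set I : Finset ℤ := Finset.Icc (0 : ℤ) (n + 1)
  have h1 : ∀ x, refinable n a 0 x = 2 * ∑ β ∈ I, a 0 β * blendFun n t (2 * x - β) :=
    refinable_zero_eq hn ht ha
  have h2 : ∀ x, refinable n (fun k => a (1 + k)) 0 x =
      2 * ∑ γ ∈ I, blend n (t 0) γ * blendFun n s (2 * x - γ) := by
    simp only [ha]
    exact refinable_zero_eq hn hs fun _ => rfl
  have h3 : ∀ β γ : ℤ,
      Integrable (fun x : ℝ => blendFun n t (2 * x - β) * blendFun n s (2 * (2 * x + α) - γ)) ∧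
      ∫ x : ℝ, blendFun n t (2 * x - β) * blendFun n s (2 * (2 * x + α) - γ) =
        1 / 4 * blendCoeff n t (2 * α + 2 * β - γ) := by
    intro β γ
    set g : ℝ → ℝ := fun x => blendFun n t x * blendFun n s (2 * x + (2 * α + 2 * β - γ : ℤ))
    have e : (fun x : ℝ => blendFun n t (2 * x - β) * blendFun n s (2 * (2 * x + α) - γ)) =
        fun x => (fun y => g (y - β)) (2 * x) := by
      ext x
      simp only [g]
      congr 2
      push_cast
      ring
    have hg : Integrable g := integrable_blendFun_mul hn ht hs _
    rw [e]
    refine ⟨(hg.comp_sub_right (β : ℝ)).comp_mul_left' two_ne_zero, ?_⟩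
    rw [Measure.integral_comp_mul_left (fun y => g (y - β)), integral_sub_right_eq_self,
      blendCoeff_eq, abs_of_pos (by positivity), smul_eq_mul]
    simp only [g, s]
    ring
  have h4 : prewaveletCoeff n a 0 α = ∑ β ∈ I, ∑ γ ∈ I,
      2 * (a 0 β * blend n (t 0) γ) * blendCoeff n t (2 * α + 2 * β - γ) := by
    rw [prewaveletCoeff_zero]
    have e : ∀ x : ℝ, refinable n a 0 x * refinable n (fun k => a (1 + k)) 0 (2 * x + α) =
        ∑ β ∈ I, ∑ γ ∈ I, 4 * (a 0 β * blend n (t 0) γ) *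
          (blendFun n t (2 * x - β) * blendFun n s (2 * (2 * x + α) - γ)) := by
      intro x
      rw [h1, h2, mul_mul_mul_comm, Finset.sum_mul_sum, Finset.mul_sum]
      refine Finset.sum_congr rfl fun β _ => ?_
      rw [Finset.mul_sum]
      refine Finset.sum_congr rfl fun γ _ => ?_
      ring
    simp only [e]
    rw [integral_finsetSum _ fun β _ => integrable_finsetSum _ fun γ _ =>
      (h3 β γ).1.const_mul _, Finset.mul_sum]
    refine Finset.sum_congr rfl fun β _ => ?_
    rw [integral_finsetSum _ fun γ _ => (h3 β γ).1.const_mul _, Finset.mul_sum]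
    refine Finset.sum_congr rfl fun γ _ => ?_
    rw [integral_const_mul, (h3 β γ).2]
    ring
  rw [h4]
  simp only [twoScale, Finset.mul_sum, Finset.sum_mul]
  rw [Finset.sum_comm (s := window n)]
  refine Finset.sum_congr rfl fun β _ => ?_
  refine Finset.sum_bij_ne_zero (fun γ _ _ => 2 * α + 2 * β - γ) ?_ ?_ ?_ ?_
  · intro γ _ h0
    by_contra h
    exact h0 (by rw [blendCoeff_eq_zero hn ht h, mul_zero])
  · intro γ _ _ γ' _ _ h
    linarith
  · intro δ _ h0
    have hγ : 2 * α - δ + 2 * β ∈ I := by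
      by_contra h
      exact h0 (by rw [blend_eq_zero _ h]; ring)
    have e : 2 * α + 2 * β - (2 * α - δ + 2 * β) = δ := by ring
    refine ⟨2 * α - δ + 2 * β, hγ, ?_, e⟩
    rwa [e]
  · intro γ _ _
    rw [show 2 * α - (2 * α + 2 * β - γ) + 2 * β = γ by ring]

theorem blendCoeff_eq_sum (hn : 1 ≤ n) (ht : Admissible t) (α : ℤ) :
    blendCoeff n t α = ∑ δ ∈ window n, twoScale n (blend n (t 0)) (blend n (t 1)) (2 * α - δ) *
      blendCoeff n (fun k => t (1 + k)) δ :=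
  prewaveletCoeff_zero_eq_sum hn (ht.comp_add 1) (fun _ => rfl) α

end

/-! ### Convergence of the coefficients to those of the spline -/

/-- A bounded nonnegative sequence with `e m ≤ (1 - η) e (m + 1) + r m` and `r → 0` tends to `0`. -/
theorem tendsto_zero_of_le_contract {e r : ℕ → ℝ} {η C : ℝ} (hη0 : 0 < η) (hη1 : η ≤ 1)
    (he0 : ∀ m, 0 ≤ e m) (heC : ∀ m, e m ≤ C) (hr : Tendsto r atTop (𝓝 0))
    (h : ∀ m, e m ≤ (1 - η) * e (m + 1) + r m) : Tendsto e atTop (𝓝 0) := by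
  refine tendsto_order.2 ⟨fun a ha => Eventually.of_forall fun m => ha.trans_le (he0 m),
    fun ε hε => ?_⟩
  obtain ⟨M, hM⟩ := eventually_atTop.1 (hr.eventually_lt_const (by positivity : 0 < η * (ε / 2)))
  -- The recursion looks forward in m, so it is iterated k times towards infinity with m fixed; the
  -- uniform bound C lets (1 - η)^k absorb the far end.
  have key : ∀ k m, M ≤ m → e m ≤ (1 - η) ^ k * C + ε / 2 := by
    intro k
    induction k with
    | zero => intro m _; linarith [heC m]
    | succ k ih =>
      intro m hm
      have h1 := mul_le_mul_of_nonneg_left (ih (m + 1) (by omega)) (sub_nonneg.2 hη1)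
      have h2 := hM m hm
      rw [pow_succ]
      linarith [h m]
  have hlim : Tendsto (fun k : ℕ => (1 - η) ^ k * C + ε / 2) atTop (𝓝 (0 * C + ε / 2)) :=
    ((tendsto_pow_atTop_nhds_zero_of_lt_one (sub_nonneg.2 hη1) (by linarith)).mul_const C).add_const
      _
  filter_upwards [eventually_ge_atTop M] with m hm
  have := ge_of_tendsto' hlim fun k => key k m hm
  linarith

theorem tendsto_blend (n : ℕ) {τ : ℕ → ℝ} {σ : ℝ} (h : Tendsto τ atTop (𝓝 σ)) (α : ℤ) :
    Tendsto (fun m => blend n (τ m) α) atTop (𝓝 (blend n σ α)) := by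
  have : Continuous fun x => blend n x α := by unfold blend; fun_prop
  exact (this.tendsto σ).comp h

theorem tendsto_twoScale (n : ℕ) {τ : ℕ → ℝ} {σ : ℝ} (h : Tendsto τ atTop (𝓝 σ)) (j : ℤ) :
    Tendsto (fun m => twoScale n (blend n (τ m)) (blend n (τ (m + 1))) j) atTop
      (𝓝 (twoScale n (blend n σ) (blend n σ) j)) :=
  (tendsto_finsetSum _ fun β _ => (tendsto_blend n h β).mul
    (tendsto_blend n (h.comp (tendsto_add_atTop_nat 1)) (j + 2 * β))).const_mul 2

theorem admissible_one : Admissible fun _ => 1 where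
  half_le _ := by norm_num
  le_one _ := le_rfl
  summable := by simp

namespace Admissible

variable {t : ℕ → ℝ}

theorem tendsto_one (ht : Admissible t) : Tendsto t atTop (𝓝 1) := by
  have := ht.summable.tendsto_atTop_zero.const_sub 1
  simpa using this

end Admissible

theorem tendsto_sum_abs_blendCoeff_sub {n : ℕ} (hn : 2 ≤ n) {t : ℕ → ℝ} (ht : Admissible t) :
    Tendsto (fun m => ∑ α ∈ window n,
      |blendCoeff n (fun k => t (m + k)) α - blendCoeff n (fun _ => 1) α|) atTop (𝓝 0) := by
  have hn1 : 1 ≤ n := by omega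
  set G : ℕ → ℤ → ℝ := fun m => blendCoeff n (fun k => t (m + k))
  set B : ℤ → ℝ := blendCoeff n (fun _ => 1)
  set c : ℕ → ℤ → ℝ := fun m => twoScale n (blend n (t m)) (blend n (t (m + 1)))
  set c' : ℤ → ℝ := twoScale n (blend n 1) (blend n 1)
  have hG : ∀ m α, G m α = ∑ δ ∈ window n, c m (2 * α - δ) * G (m + 1) δ := by
    intro m α
    have h := blendCoeff_eq_sum hn1 (ht.comp_add m) α
    simpa only [G, c, add_zero, add_assoc] using h
  have hB : ∀ α, B α = ∑ δ ∈ window n, c' (2 * α - δ) * B δ :=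
    blendCoeff_eq_sum hn1 admissible_one
  have hη : (1 / 2 ^ (n + 2) : ℝ) ≤ 1 / 2 :=
    one_div_le_one_div_of_le two_pos (le_self_pow₀ one_le_two (by omega))
  have hη0 : (0 : ℝ) < 1 / 2 ^ (n + 2) := by positivity
  refine tendsto_zero_of_le_contract (η := 2 * (1 / 2 ^ (n + 2)) ^ 2)
    (C := ∑ α ∈ window n, (2 * ((2 * Real.exp (∑' j, (1 - t j))) ^ 2 * (n + 1)) + |B α|))
    (r := fun m => ∑ α ∈ window n, |∑ δ ∈ window n, (c m (2 * α - δ) - c' (2 * α - δ)) * B δ|)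
    (by positivity) (by nlinarith) (fun m => Finset.sum_nonneg fun _ _ => abs_nonneg _)
    (fun m => Finset.sum_le_sum fun α _ => ?_) ?_ (fun m => ?_)
  · refine (abs_sub _ _).trans (add_le_add_left ?_ _)
    refine (abs_blendCoeff_le hn1 (ht.comp_add m) α).trans ?_
    have := tsum_one_sub_comp_add_le ht m
    gcongr
  · have h : ∀ j, Tendsto (fun m => c m j - c' j) atTop (𝓝 0) := fun j => by
      rw [← sub_self (c' j)]
      exact (tendsto_twoScale n ht.tendsto_one j).sub_const (c' j)
    have h2 := tendsto_finsetSum (window n) fun α _ =>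
      (tendsto_finsetSum (window n) fun δ _ => (h (2 * α - δ)).mul_const (B δ)).abs
    simpa using h2
  · have hd : ∑ δ ∈ window n, (G (m + 1) δ - B δ) = 0 := by
      rw [Finset.sum_sub_distrib, sum_blendCoeff hn (ht.comp_add _),
        sum_blendCoeff hn admissible_one, sub_self]
    have h1 := twoScale_blend_contract hn (ht.half_le m) (ht.le_one m) (ht.half_le (m + 1))
      (ht.le_one (m + 1)) _ hd
    refine le_trans ?_ (add_le_add_left h1 _)
    rw [← Finset.sum_add_distrib]
    refine Finset.sum_le_sum fun α _ => ?_
    have e : G m α - B α = ∑ δ ∈ window n, c m (2 * α - δ) * (G (m + 1) δ - B δ) +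
        ∑ δ ∈ window n, (c m (2 * α - δ) - c' (2 * α - δ)) * B δ := by
      rw [hG m α, hB α, ← Finset.sum_sub_distrib, ← Finset.sum_add_distrib]
      refine Finset.sum_congr rfl fun δ _ => ?_
      ring
    change |G m α - B α| ≤ _
    rw [e]
    exact abs_add_le _ _

/-! ### Application to the given masks -/

/-- The weights `2^{-k^{-μ}}` of the masks `mask n μ k`. -/
noncomputable def tension (μ : ℝ) (k : ℕ) : ℝ := (2 : ℝ) ^ (-(k : ℝ) ^ (-μ))

theorem admissible_tension {μ : ℝ} (hμ : 1 < μ) : Admissible (tension μ) := by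
  have h0 : ∀ k : ℕ, 0 ≤ (k : ℝ) ^ (-μ) := fun k => by positivity
  have h1 : ∀ k : ℕ, (k : ℝ) ^ (-μ) ≤ 1 := by
    intro k
    rcases Nat.eq_zero_or_pos k with rfl | hk
    · rw [Nat.cast_zero, Real.zero_rpow (by linarith)]; exact zero_le_one
    · exact Real.rpow_le_one_of_one_le_of_nonpos (by exact_mod_cast hk) (by linarith)
  have hle : ∀ k, tension μ k ≤ 1 := fun k =>
    Real.rpow_le_one_of_one_le_of_nonpos one_le_two (by linarith [h0 k])
  refine ⟨fun k => ?_, hle, ?_⟩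
  · calc (1 / 2 : ℝ) = 2 ^ (-1 : ℝ) := by rw [Real.rpow_neg_one]; norm_num
      _ ≤ _ := Real.rpow_le_rpow_of_exponent_le one_le_two (by linarith [h1 k])
  · refine Summable.of_nonneg_of_le (fun k => by linarith [hle k]) (fun k => ?_)
      (Real.summable_nat_rpow.2 (by linarith : -μ < -1))
    -- Summability comes from 1 - 2^(-s) ≤ s log 2 ≤ s with s = k^(-μ).
    have hl : Real.log 2 ≤ 1 := by linarith [Real.log_two_lt_d9]
    have h2 := Real.add_one_le_exp (Real.log 2 * -(k : ℝ) ^ (-μ))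
    rw [← Real.rpow_def_of_pos two_pos] at h2
    have h3 := mul_le_mul_of_nonneg_right hl (h0 k)
    unfold tension
    linarith

section

variable {n : ℕ} {μ : ℝ}

theorem mask_eq_blend_tension (hn : 1 ≤ n) {m : ℕ} (hm : m ≠ 0) :
    mask n μ m = blend n (tension μ m) :=
  mask_eq_blend hn μ hm

theorem mask_nonneg (hn : 1 ≤ n) (hμ : 1 < μ) (m : ℕ) (α : ℤ) : 0 ≤ mask n μ m α := by
  rcases eq_or_ne m 0 with rfl | hm
  · simp only [mask, if_true]; split_ifs <;> norm_num
  · rw [mask_eq_blend_tension hn hm]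
    exact blend_nonneg n ((admissible_tension hμ).nonneg m) ((admissible_tension hμ).le_one m) α

theorem sum_mask (hn : 1 ≤ n) (μ : ℝ) (m : ℕ) :
    ∑ α ∈ Finset.Icc (0 : ℤ) (n + 1), mask n μ m α = 1 := by
  rcases eq_or_ne m 0 with rfl | hm
  · have h : ({0, 1} : Finset ℤ) ⊆ Finset.Icc (0 : ℤ) (n + 1) := by
      intro x hx
      simp only [Finset.mem_insert, Finset.mem_singleton, Finset.mem_Icc] at *
      omega
    rw [← Finset.sum_subset h fun x _ hx => by simpa [mask] using hx]
    simp only [mask, if_true, Finset.sum_pair zero_ne_one, true_or, or_true]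
    norm_num
  · rw [mask_eq_blend_tension hn hm, sum_blend hn]

theorem coeff_mask_eq_blendCoeff (hn : 1 ≤ n) {m : ℕ} (hm : m ≠ 0) (α : ℤ) :
    prewaveletCoeff n (mask n μ) m α = blendCoeff n (fun k => tension μ (m + k)) α := by
  rw [prewaveletCoeff_eq_comp_add, blendCoeff]
  congr 1
  ext k : 1
  exact mask_eq_blend_tension hn (by omega)

theorem coeff_spline_eq_blendCoeff (n : ℕ) (α : ℤ) :
    prewaveletCoeff n (fun _ => splineMask n) 0 α = blendCoeff n (fun _ => 1) α := by
  simp only [splineMask_eq_blend, blendCoeff]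

theorem coeff_mask_eq_sum (hn : 1 ≤ n) (hμ : 1 < μ) (m : ℕ) (α : ℤ) :
    prewaveletCoeff n (mask n μ) m α = ∑ δ ∈ window n, iterMask n μ m (2 * α - δ) *
      prewaveletCoeff n (mask n μ) (m + 1) δ := by
  have h := prewaveletCoeff_zero_eq_sum hn ((admissible_tension hμ).comp_add (m + 1))
    (a := fun k => mask n μ (m + k)) (fun k => by
      rw [← add_assoc]; exact mask_eq_blend_tension hn (by omega)) α
  rw [prewaveletCoeff_eq_comp_add, h]
  refine Finset.sum_congr rfl fun δ _ => ?_
  rw [coeff_mask_eq_blendCoeff hn (by omega : m + 1 ≠ 0), add_zero, add_zero,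
    ← mask_eq_blend_tension hn (by omega : m + 1 ≠ 0)]
  rfl

theorem sigmaG_of_ne_zero (n : ℕ) {m : ℕ} (hm : m ≠ 0) : sigmaG n m = window n := by
  rw [sigmaG, if_neg hm, window]

theorem coeffVec_eq_mulVec (hn : 1 ≤ n) (hμ : 1 < μ) (m : ℕ) :
    coeffVec n μ m = (iterMatrix n μ m).mulVec (coeffVec n μ (m + 1)) := by
  ext α
  rw [coeffVec, coeff_mask_eq_sum hn hμ, ← sigmaG_of_ne_zero n (by omega : m + 1 ≠ 0),
    ← Finset.sum_coe_sort]
  rfl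

theorem iterVec_sub_coeffVec_succ (hn : 1 ≤ n) (hμ : 1 < μ) (k m : ℕ) :
    iterVec n μ (k + 1) m - coeffVec n μ m =
      (iterMatrix n μ m).mulVec (iterVec n μ k (m + 1) - coeffVec n μ (m + 1)) := by
  rw [Matrix.mulVec_sub, ← coeffVec_eq_mulVec hn hμ, iterVec]

/-- Only the second mask, at level m + 1 ≥ 1, needs the sum rule, so level 0 with its smaller index
set is covered. -/
theorem sum_abs_iterMatrix_mulVec_le (hn : 2 ≤ n) (hμ : 1 < μ) (m : ℕ)
    (v : sigmaG n (m + 1) → ℝ) :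
    ∑ i, |(iterMatrix n μ m).mulVec v i| ≤ ∑ j, |v j| := by
  have hn1 : 1 ≤ n := by omega
  refine sum_abs_sum_le Finset.univ Finset.univ (fun i j => iterMatrix n μ m i j)
    (fun i _ j _ => twoScale_nonneg (mask_nonneg hn1 hμ m) (mask_nonneg hn1 hμ (m + 1)) _)
    (fun j _ => ?_) v
  have ht := admissible_tension hμ
  have h := sum_twoScale_le hn (mask_nonneg hn1 hμ m) (sum_mask hn1 μ m) (ht.nonneg (m + 1))
    (ht.le_one (m + 1)) j (sigmaG n m)
  rw [← mask_eq_blend_tension hn1 (by omega : m + 1 ≠ 0), ← Finset.sum_coe_sort] at h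
  exact h

theorem sum_abs_iterVec_sub_le (hn : 2 ≤ n) (hμ : 1 < μ) (k m : ℕ) :
    ∑ i, |(iterVec n μ k m - coeffVec n μ m) i| ≤
      ∑ i, |(splineCoeffVec n (m + k) - coeffVec n μ (m + k)) i| := by
  induction k generalizing m with
  | zero => exact le_rfl
  | succ k ih =>
    rw [iterVec_sub_coeffVec_succ (by omega) hμ, show m + (k + 1) = m + 1 + k by ring]
    exact (sum_abs_iterMatrix_mulVec_le hn hμ m _).trans (ih (m + 1))

theorem tendsto_sum_abs_splineCoeffVec_sub (hn : 2 ≤ n) (hμ : 1 < μ) :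
    Tendsto (fun m => ∑ i, |(splineCoeffVec n m - coeffVec n μ m) i|) atTop (𝓝 0) := by
  refine (tendsto_sum_abs_blendCoeff_sub hn (admissible_tension hμ)).congr' ?_
  filter_upwards [eventually_ne_atTop 0] with m hm
  rw [← sigmaG_of_ne_zero n hm, ← Finset.sum_coe_sort]
  refine Finset.sum_congr rfl fun i _ => ?_
  rw [Pi.sub_apply, splineCoeffVec, coeffVec, coeff_spline_eq_blendCoeff,
    coeff_mask_eq_blendCoeff (by omega) hm, abs_sub_comm]

end

/-! ### Equivalence of norms in finite dimension -/

section

variable {ι : Type*} [Fintype ι]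

theorem exists_seminorm_le_sum_abs (p : Seminorm ℝ (ι → ℝ)) :
    ∃ K : ℝ, 0 ≤ K ∧ ∀ v, p v ≤ K * ∑ i, |v i| := by
  classical
  refine ⟨∑ j, p (Pi.single j 1), Finset.sum_nonneg fun _ _ => apply_nonneg p _, fun v => ?_⟩
  have hv : v = ∑ i, v i • Pi.single i (1 : ℝ) := pi_eq_sum_univ' v
  calc p v = p (∑ i, v i • Pi.single i (1 : ℝ)) := by rw [← hv]
    _ ≤ ∑ i, p (v i • Pi.single i (1 : ℝ)) :=
        Finset.le_sum_of_subadditive p (map_zero p).le (map_add_le_add p) _ _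
    _ ≤ ∑ i, (∑ j, p (Pi.single j 1)) * |v i| := by
        refine Finset.sum_le_sum fun i _ => ?_
        rw [map_smul_eq_mul, Real.norm_eq_abs, mul_comm]
        exact mul_le_mul_of_nonneg_right (Finset.single_le_sum
          (f := fun j => p (Pi.single j 1)) (fun _ _ => apply_nonneg p _) (Finset.mem_univ i))
          (abs_nonneg _)
    _ = _ := by rw [Finset.mul_sum]

theorem sum_abs_le_card_mul_norm (v : ι → ℝ) : ∑ i, |v i| ≤ Fintype.card ι * ‖v‖ := by
  simpa using Finset.sum_le_card_nsmul Finset.univ (fun i => |v i|) ‖v‖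
    fun i _ => norm_le_pi_norm v i

/-- A definite seminorm is continuous, hence has a positive lower bound on the compact unit sphere;
homogeneity does the rest. -/
theorem exists_sum_abs_le_seminorm (p : Seminorm ℝ (ι → ℝ)) (hp : ∀ v, p v = 0 → v = 0) :
    ∃ K : ℝ, ∀ v, ∑ i, |v i| ≤ K * p v := by
  obtain ⟨K, hK, hpK⟩ := exists_seminorm_le_sum_abs p
  have hcont : Continuous p := by
    refine (LipschitzWith.of_dist_le' (K := K * Fintype.card ι) fun v w => ?_).continuous
    rw [Real.dist_eq, dist_eq_norm, mul_assoc]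
    exact (abs_sub_map_le_sub p v w).trans ((hpK _).trans
      (mul_le_mul_of_nonneg_left (sum_abs_le_card_mul_norm _) hK))
  obtain ⟨c, hc, hle⟩ := (isCompact_sphere (0 : ι → ℝ) 1).exists_forall_le' hcont.continuousOn
    (a := 0) fun v hv => by
      refine (apply_nonneg p v).lt_of_ne fun h => ?_
      rw [hp v h.symm] at hv
      simp at hv
  refine ⟨Fintype.card ι / c, fun v => (sum_abs_le_card_mul_norm v).trans ?_⟩
  rw [div_mul_eq_mul_div, mul_div_assoc]
  refine mul_le_mul_of_nonneg_left ((le_div_iff₀ hc).2 ?_) (Nat.cast_nonneg _)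
  rcases eq_or_ne v 0 with rfl | hv
  · simp
  · have hv0 : 0 < ‖v‖ := norm_pos_iff.2 hv
    have h := hle (‖v‖⁻¹ • v) (by simp [norm_smul, hv0.ne'])
    rw [map_smul_eq_mul, norm_inv, norm_norm, inv_mul_eq_div, le_div_iff₀ hv0] at h
    linarith

end

end Prewavelet

theorem mainTheorem9 (n : ℕ) (hn : 2 ≤ n) (μ : ℝ) (hμ : 1 < μ) (m : ℕ)
    (N : ∀ s : Finset ℤ, Seminorm ℝ (s → ℝ))
    (hN : ∀ (s : Finset ℤ) (v : s → ℝ), N s v = 0 → v = 0) :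
    Tendsto (fun k : ℕ => N (Prewavelet.sigmaG n m)
        (Prewavelet.iterVec n μ k m - Prewavelet.coeffVec n μ m)) atTop (𝓝 0) ∧
      ∃ γ : ℝ, 0 < γ ∧ ∀ k : ℕ,
        N (Prewavelet.sigmaG n m) (Prewavelet.iterVec n μ k m - Prewavelet.coeffVec n μ m) ≤
          γ * N (Prewavelet.sigmaG n (m + k))
            (Prewavelet.splineCoeffVec n (m + k) - Prewavelet.coeffVec n μ (m + k)) := by
  obtain ⟨K, hK, hle⟩ := Prewavelet.exists_seminorm_le_sum_abs (N (Prewavelet.sigmaG n m))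
  choose L hL using fun s => Prewavelet.exists_sum_abs_le_seminorm (N s) (hN s)
  have h1 : ∀ k, N (Prewavelet.sigmaG n m)
      (Prewavelet.iterVec n μ k m - Prewavelet.coeffVec n μ m) ≤
      K * ∑ i, |(Prewavelet.splineCoeffVec n (m + k) - Prewavelet.coeffVec n μ (m + k)) i| :=
    fun k => (hle _).trans
      (mul_le_mul_of_nonneg_left (Prewavelet.sum_abs_iterVec_sub_le hn hμ k m) hK)
  constructor
  · have h2 := ((Prewavelet.tendsto_sum_abs_splineCoeffVec_sub hn hμ).comp
      (tendsto_add_atTop_nat m)).const_mul K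
    rw [mul_zero] at h2
    refine squeeze_zero (fun k => apply_nonneg _ _) (fun k => ?_) h2
    rw [Function.comp_apply, add_comm k m]
    exact h1 k
  -- Only two index sets occur over all levels, so one constant serves every k.
  · set C := |L (Prewavelet.sigmaG n 0)| + |L (Prewavelet.window n)|
    have hC : ∀ j, L (Prewavelet.sigmaG n j) ≤ C := by
      intro j
      rcases eq_or_ne j 0 with rfl | hj
      · exact (le_abs_self _).trans (le_add_of_nonneg_right (abs_nonneg _))
      · rw [Prewavelet.sigmaG_of_ne_zero n hj]
        exact (le_abs_self _).trans (le_add_of_nonneg_left (abs_nonneg _))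
    -- Adding 1 makes the constant strictly positive.
    refine ⟨K * C + 1, by positivity, fun k => (h1 k).trans ?_⟩
    have h0 := apply_nonneg (N (Prewavelet.sigmaG n (m + k)))
      (Prewavelet.splineCoeffVec n (m + k) - Prewavelet.coeffVec n μ (m + k))
    have h2 := (hL (Prewavelet.sigmaG n (m + k)) (Prewavelet.splineCoeffVec n (m + k) -
      Prewavelet.coeffVec n μ (m + k))).trans (mul_le_mul_of_nonneg_right (hC (m + k)) h0)
    have h3 := mul_le_mul_of_nonneg_left h2 hK
    linarith
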